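/- **Model.** Let $B_1^*,B_2^*\in\mathbb R^{p\times K}$ have nonnegative entries, with columns $b_k^{1*},b_k^{2*}$ satisfying $\|b_k^{1*}\|_2=\|b_k^{2*}\|_2$ for all $k$. Put $\Theta_k^*=b_k^{1*}(b_k^{2*})^\top$ and assume $\|\Theta_k^*\|_2\ge\sigma>0$ for all $k$. Assume the sparsity condition (SC) $\|B_1^*\|_0=\|B_2^*\|_0=s^*$, where $\|\cdot\|_0$ is the number of nonzero entries. For known vectors $m_i\in\mathbb R^K$ with $m_{ik}\ge 0$, $\sum_k m_{ik}=1$, and $M_i=\operatorname{diag}(m_i)$, we observe $X_i=B_1^*M_iB_2^{*\top}+E_i$, $i=1,2,\dots$. The random $p\times p$ matrices $E_i$ are independent, with entries of mean $0$ and uniformly bounded second moments. **Algorithm** (from $X_1,\dots,X_n$; parameters $\lambda>0$, $\eta>0$, $s\in\mathbb N$). Let $f(B_1,B_2)=\frac1{2n}\sum_{i\le n}\|X_i-B_1M_iB_2^\top\|_F^2$ and $g(B_1,B_2)=\frac\lambda2\sum_k(\|b_k^1\|_2^2-\|b_k^2\|_2^2)^2$. *Initialization.* Let $\hat\Theta$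 be a global minimizer of $\frac1{2n}\sum_{i\le n}\|X_i-\sum_k m_{ik}\Theta_k\|_F^2$ over all $\Theta_1,\dots,\Theta_K\in\mathbb R^{p\times p}$. Let $(u_k,s_k,v_k)$ be the largest singular value of $\hat\Theta_k$ with a pair of unit singular vectors, the common sign being chosen so that the entries of $u_k+v_k$ have nonnegative sum. The columns of $B_1^{(0)},B_2^{(0)}$ are $\sqrt{s_k}\,u_k$ and $\sqrt{s_k}\,v_k$. *Iteration.* For $a=1,2$, $$B_a^{(t+1)}=\mathrm{Hard}\big(\big[B_a^{(t)}-\eta\nabla_{B_a}f(B_1^{(t)},B_2^{(t)})-\eta\nabla_{B_a}g(B_1^{(t)},B_2^{(t)})\big]_+,\,s\big),$$ where $[\cdot]_+$ replaces negative entries by $0$, and $\mathrm{Hard}(\cdot,s)$ keeps the $s$ largest entries (ties broken arbitrarily) and zeroes out the others. **Notation.** $B=[B_1,B_2]$, $d^2(B,B^*)=\|B_1-B_1^*\|_F^2+\|B_2-B_2^*\|_F^2$, and $L_\Theta=1$. The topic condition (TC) at $n$ is $H_\Theta\succeq\mu_\Theta I_K$, where $(H_\Theta)_{kl}=\frac1n\sum_{i\le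 n}m_{ik}m_{il}$. The statistical error is $$e_{\mathrm{stat},\Theta}=\sup_\Delta\sum_{k=1}^K\Big\langle\frac1n\sum_{i\le n}m_{ik}E_i,\ \Delta_k\Big\rangle,$$ the supremum being over $\Delta=(\Delta_1,\dots,\Delta_K)$, $\Delta_k\in\mathbb R^{p\times p}$, with $\operatorname{rank}\Delta_k\le2$, $\|\Delta_k\|_0\le s$ and $\sum_k\|\Delta_k\|_F^2=1$. **Theorem 1.** Let $\mu_\Theta,\lambda,\eta,\sigma>0$, $c\ge1$, and let $s^*,s\in\mathbb N$ with $s=cs^*$. There are constants $\beta\in[0,1)$ and $C\ge0$, depending only on $\mu_\Theta,\lambda,\eta,\sigma,c,s^*$, such that the following holds for all $p$, $K$, $B^*$, $(m_i)$ and $(E_i)$ as above. For every $\delta>0$ there is $N$ such that for every $n\ge N$ at which (TC) holds, with probability at least $1-\delta$: for every run of the algorithm for which $$\eta\le\frac1{16\|B^{(0)}\|_2^2}\min\Big\{\frac1{2(\mu_\Theta+L_\Theta)},\,1,\,\frac1\lambda\Big\},$$ one has, for all $T\ge0$, $$d^2(B^{(T)},B^*)\le\beta^T d^2(B^{(0)},B^*)+C\,e_{\mathrm{stat},\Theta}^2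 .$$ (For $\lambda\le2$ the term $1/\lambda$ does not affect the minimum.) -/

import Mathlib

open MeasureTheory ProbabilityTheory

namespace InflRec

noncomputable section

/-- Squared Frobenius norm of a real matrix. -/
def frobSq {a b : ℕ} (A : Matrix (Fin a) (Fin b) ℝ) : ℝ := ∑ j, ∑ l, A j l ^ 2

/-- Trace inner product `⟨A, B⟩ = tr (Aᵀ B)`. -/
def innerMat {a b : ℕ} (A B : Matrix (Fin a) (Fin b) ℝ) : ℝ := (A.transpose * B).trace

/-- Number of nonzero entries of a matrix. -/
def nnz {a b : ℕ} (A : Matrix (Fin a) (Fin b) ℝ) : ℕ :=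
  Set.ncard {q : Fin a × Fin b | A q.1 q.2 ≠ 0}

/-- Spectral norm (largest singular value): the operator norm between Euclidean spaces. -/
def specNorm {m n : Type*} [Fintype m] [Fintype n] [DecidableEq n] (A : Matrix m n ℝ) : ℝ :=
  ‖LinearMap.toContinuousLinearMap (Matrix.toEuclideanLin A)‖

/-- The rank-one matrix `Θ_k = b_k¹ (b_k²)ᵀ` built from the `k`-th columns. -/
def theta {p K : ℕ} (B1 B2 : Matrix (Fin p) (Fin K) ℝ) (k : Fin K) : Matrix (Fin p) (Fin p) ℝ :=
  Matrix.vecMulVec (B1.col k) (B2.col k)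

/-- The observation `X_i = B₁* M_i B₂*ᵀ + E_i`, with `M_i = diag m_i`. -/
def observe {p K : ℕ} (B1 B2 : Matrix (Fin p) (Fin K) ℝ) (m : ℕ → Fin K → ℝ)
    (E : ℕ → Matrix (Fin p) (Fin p) ℝ) (i : ℕ) : Matrix (Fin p) (Fin p) ℝ :=
  B1 * Matrix.diagonal (m i) * B2.transpose + E i

/-- The loss `f(B₁, B₂) = (1/2n) ∑_i ‖X_i - B₁ M_i B₂ᵀ‖_F²`; the first `n` observations are those
with index `0, …, n - 1`. -/
def loss {p K : ℕ} (n : ℕ) (m : ℕ → Fin K → ℝ) (X : ℕ → Matrix (Fin p) (Fin p) ℝ)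
    (B1 B2 : Matrix (Fin p) (Fin K) ℝ) : ℝ :=
  1 / (2 * (n : ℝ)) * ∑ i ∈ Finset.range n,
    frobSq (X i - B1 * Matrix.diagonal (m i) * B2.transpose)

/-- The convex relaxation `f(Θ) = (1/2n) ∑_i ‖X_i - ∑_k m_ik Θ_k‖_F²`, over unconstrained `Θ`. -/
def relaxedLoss {p K : ℕ} (n : ℕ) (m : ℕ → Fin K → ℝ) (X : ℕ → Matrix (Fin p) (Fin p) ℝ)
    (Th : Fin K → Matrix (Fin p) (Fin p) ℝ) : ℝ :=
  1 / (2 * (n : ℝ)) * ∑ i ∈ Finset.range n, frobSq (X i - ∑ k, m i k • Th k)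

/-- The balancing regularizer `g(B₁, B₂) = (λ/2) ∑_k (‖b_k¹‖² - ‖b_k²‖²)²`. -/
def balReg {p K : ℕ} (lam : ℝ) (B1 B2 : Matrix (Fin p) (Fin K) ℝ) : ℝ :=
  lam / 2 * ∑ k, ((∑ j, B1 j k ^ 2) - ∑ j, B2 j k ^ 2) ^ 2

/-- Gradient of a function of a matrix: the matrix of its partial derivatives. -/
def matGrad {a b : ℕ} (F : Matrix (Fin a) (Fin b) ℝ → ℝ) (A : Matrix (Fin a) (Fin b) ℝ) :
    Matrix (Fin a) (Fin b) ℝ :=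
  Matrix.of fun j k => deriv (fun t : ℝ => F (A + t • Matrix.single j k (1 : ℝ))) 0

/-- `[B]_+` keeps the positive entries and zeros out the others. -/
def posPart {a b : ℕ} (A : Matrix (Fin a) (Fin b) ℝ) : Matrix (Fin a) (Fin b) ℝ :=
  A.map fun x => max x 0

/-- `A'` is a value of `Hard(A, s)`: `s` entries of `A` that are largest in magnitude are kept (all
entries, if there are at most `s`) and the others are zeroed out. Ties are broken arbitrarily. -/
def IsHard {a b : ℕ} (s : ℕ) (A A' : Matrix (Fin a) (Fin b) ℝ) : Prop :=
  ∃ S : Finset (Fin a × Fin b), S.card = min s (a * b) ∧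
    (∀ q ∈ S, ∀ r ∉ S, |A r.1 r.2| ≤ |A q.1 q.2|) ∧
    ∀ j k, A' j k = if (j, k) ∈ S then A j k else 0

/-- `(u, σ, v)` is a rank-one truncated SVD of `A`: a pair of unit singular vectors for the largest
singular value `σ = ‖A‖₂`. -/
def IsTopSVD {p : ℕ} (A : Matrix (Fin p) (Fin p) ℝ) (u : Fin p → ℝ) (sv : ℝ) (v : Fin p → ℝ) :
    Prop :=
  ∑ j, u j ^ 2 = 1 ∧ ∑ j, v j ^ 2 = 1 ∧ sv = specNorm A ∧
    A.mulVec v = sv • u ∧ A.transpose.mulVec u = sv • v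

/-- `(B₁, B₂)` is obtained by the initialization: a global minimizer `Θ̂` of the convex relaxation,
a rank-one SVD `(u_k, s_k, v_k)` of each `Θ̂_k`, and the columns `√s_k u_k`, `√s_k v_k`. The pair
`(u_k, v_k)` is determined only up to a common sign; it is chosen to point to the nonnegative
side, i.e. with nonnegative sum of entries. -/
def IsInit {p K : ℕ} (n : ℕ) (m : ℕ → Fin K → ℝ) (X : ℕ → Matrix (Fin p) (Fin p) ℝ)
    (B1 B2 : Matrix (Fin p) (Fin K) ℝ) : Prop :=
  ∃ (Th : Fin K → Matrix (Fin p) (Fin p) ℝ) (u v : Fin K → Fin p → ℝ) (sv : Fin K → ℝ),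
    (∀ Th', relaxedLoss n m X Th ≤ relaxedLoss n m X Th') ∧
    (∀ k, IsTopSVD (Th k) (u k) (sv k) (v k)) ∧
    (∀ k, 0 ≤ ∑ j, (u k j + v k j)) ∧
    (∀ j k, B1 j k = Real.sqrt (sv k) * u k j) ∧
    (∀ j k, B2 j k = Real.sqrt (sv k) * v k j)

/-- One iteration: from `(B₁, B₂)` to `(B₁', B₂')`. Both updates use the old pair. -/
def IsStep {p K : ℕ} (n : ℕ) (m : ℕ → Fin K → ℝ) (X : ℕ → Matrix (Fin p) (Fin p) ℝ)
    (lam η : ℝ) (s : ℕ) (B1 B2 B1' B2' : Matrix (Fin p) (Fin K) ℝ) : Prop :=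
  IsHard s (posPart (B1 - η • matGrad (fun Z => loss n m X Z B2) B1
      - η • matGrad (fun Z => balReg lam Z B2) B1)) B1' ∧
  IsHard s (posPart (B2 - η • matGrad (fun Z => loss n m X B1 Z) B2
      - η • matGrad (fun Z => balReg lam B1 Z) B2)) B2'

/-- `t ↦ (B₁^(t), B₂^(t))` is a run of the algorithm. -/
def IsRun {p K : ℕ} (n : ℕ) (m : ℕ → Fin K → ℝ) (X : ℕ → Matrix (Fin p) (Fin p) ℝ)
    (lam η : ℝ) (s : ℕ) (B1 B2 : ℕ → Matrix (Fin p) (Fin K) ℝ) : Prop :=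
  IsInit n m X (B1 0) (B2 0) ∧
    ∀ t, IsStep n m X lam η s (B1 t) (B2 t) (B1 (t + 1)) (B2 (t + 1))

/-- `d²(B, B*) = ‖B₁ - B₁*‖_F² + ‖B₂ - B₂*‖_F²`. -/
def dSq {p K : ℕ} (B1 B2 C1 C2 : Matrix (Fin p) (Fin K) ℝ) : ℝ :=
  frobSq (B1 - C1) + frobSq (B2 - C2)

/-- The topic Gram matrix `H_Θ`, with entries `(1/n) ∑_i m_ik m_il`. -/
def topicGram {K : ℕ} (n : ℕ) (m : ℕ → Fin K → ℝ) : Matrix (Fin K) (Fin K) ℝ :=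
  Matrix.of fun k l => 1 / (n : ℝ) * ∑ i ∈ Finset.range n, m i k * m i l

/-- Topic condition `H_Θ ⪰ μ I`. -/
def TopicCondition {K : ℕ} (μ : ℝ) (n : ℕ) (m : ℕ → Fin K → ℝ) : Prop :=
  (topicGram n m - μ • (1 : Matrix (Fin K) (Fin K) ℝ)).PosSemidef

/-- The test directions `Δ = [Δ_1, …, Δ_K]`: blocks of rank at most two with at most `s` nonzero
entries, of total Frobenius norm one. -/
def statDirections (p K s : ℕ) : Set (Fin K → Matrix (Fin p) (Fin p) ℝ) :=
  {D | (∀ k, (D k).rank ≤ 2) ∧ (∀ k, nnz (D k) ≤ s) ∧ ∑ k, frobSq (D k) = 1}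

/-- The statistical error `sup_Δ ∑_k ⟨(1/n) ∑_i m_ik E_i, Δ_k⟩`. -/
def statError {p K : ℕ} (s n : ℕ) (m : ℕ → Fin K → ℝ) (E : ℕ → Matrix (Fin p) (Fin p) ℝ) : ℝ :=
  sSup ((fun D : Fin K → Matrix (Fin p) (Fin p) ℝ =>
    ∑ k, innerMat ((1 / (n : ℝ)) • ∑ i ∈ Finset.range n, m i k • E i) (D k)) ''
      statDirections p K s)

/-- The noise matrices are independent over the observations, and their entries have mean zero and
second moments bounded by `V`. They need not be identically distributed, and the entries of one
noise matrix may be dependent. -/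
structure NoiseCondition {p : ℕ} {Om : Type*} [MeasurableSpace Om] (P : Measure Om)
    (E : ℕ → Om → Matrix (Fin p) (Fin p) ℝ) (V : ℝ) : Prop where
  indep : iIndepFun (fun (i : ℕ) (w : Om) (q : Fin p × Fin p) => E i w q.1 q.2) P
  memLp : ∀ i j l, MemLp (fun w => E i w j l) 2 P
  mean : ∀ i j l, ∫ w, E i w j l ∂P = 0
  second : ∀ i j l, ∫ w, E i w j l ^ 2 ∂P ≤ V

end

end InflRec

/-!
The argument is local around the true pair `b = (b₁, b₂)`. Since the sample size beyond which the
bound must hold may depend on the truth and on the dimensions, the averaged noise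
`G_k = (1/n) ∑_i m_ik E_i` may be assumed smaller than any threshold depending on them
(`NoiseCondition.exists_event`, Chebyshev's inequality). Only the contraction rate and the factor of
the statistical error have to be uniform.

*Initialization.* Comparing the relaxed minimizer with the truth, the topic condition gives
`μ² ∑ ‖Θ̂_k - Θ_k‖² ≤ 4 ∑ ‖G_k‖²` (`sum_frobSq_relaxed_sub_le`). Each `Θ_k = b_k¹ (b_k²)ᵀ` has rank
one and nonnegative balanced factors, so the rescaled top singular pair of `Θ̂_k`, with the
nonnegative sign, is close to `(b_k¹, b_k²)` (`IsTopSVD.close`). Hence the run starts in any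
prescribed neighbourhood of the truth.

*Contraction.* At a balanced pair the Hessian of the noise-free objective is of Gauss-Newton type,
with quadratic form
`Q(D) = (1/n) ∑_i ‖∑_k m_ik (d_k¹ b_k²ᵀ + b_k¹ d_k²ᵀ)‖² + 4λ ∑_k (⟨b_k¹, d_k¹⟩ - ⟨b_k², d_k²⟩)²`.
The loss is degenerate in the direction `d_k¹ = b_k¹`, `d_k² = -b_k²`, which is where the regularizer
is positive; together they give `Q(D) ≥ min(μ, 4λ) σ ‖D‖²` (`le_hessForm_self`), while the step-size
rule gives `η Q(D) ≤ ‖D‖²` (`mul_hessForm_self_le`). So a linearized gradient step contracts the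
squared distance by the factor `1 - η min(μ, 4λ) σ` (`frobSq_linear_step_le`). The true update
differs from it by the noise at the truth `η G_k b_k` and by a remainder which is a small multiple of
the current error (`abs_gradStep_remainder_le`).

*Thresholding.* Near the truth the entries on the support of `b` dominate all others, so the kept
set contains this support and thresholding costs no expansion factor
(`IsHard.exists_frobSq_sub_le`). On the at most `s` kept entries, and because the columns of `b`
are sparse, the noise at the truth is bounded by the entries of `G_k`, hence by the statistical error
with a factor depending only on `s` and `η` (`abs_noiseAvg_le_statError`, `sq_mul_sum_noise_le`).

`IsStep.dSq_le` combines these into one contracting step, which `le_of_contraction` iterates: the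
noise threshold is chosen so that the run never leaves the neighbourhood.
-/

namespace InflRec

/-! ### Spectral norm and perturbation of the top singular pair -/

lemma specNorm_nonneg {m n : Type*} [Fintype m] [Fintype n] [DecidableEq n] (A : Matrix m n ℝ) :
    0 ≤ specNorm A := norm_nonneg _

lemma norm_toLp_sq {n : Type*} [Fintype n] (x : n → ℝ) :
    ‖WithLp.toLp 2 x‖ ^ 2 = ∑ j, x j ^ 2 := by
  rw [EuclideanSpace.norm_sq_eq]
  simp

lemma sum_sq_mulVec_le {m n : Type*} [Fintype m] [Fintype n] [DecidableEq n] (A : Matrix m n ℝ)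
    (y : n → ℝ) : ∑ i, A.mulVec y i ^ 2 ≤ specNorm A ^ 2 * ∑ j, y j ^ 2 := by
  have h := (LinearMap.toContinuousLinearMap (Matrix.toEuclideanLin A)).le_opNorm (WithLp.toLp 2 y)
  have h2 := pow_le_pow_left₀ (norm_nonneg _) h 2
  rw [mul_pow, norm_toLp_sq, EuclideanSpace.norm_sq_eq] at h2
  simpa [specNorm] using h2

lemma sum_mul_mulVec_le {m n : Type*} [Fintype m] [Fintype n] [DecidableEq n] (A : Matrix m n ℝ)
    (x : m → ℝ) (y : n → ℝ) {r : ℝ} (hx : ∑ i, x i ^ 2 = r ^ 2)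
    (hy : ∑ j, y j ^ 2 = r ^ 2) : ∑ i, x i * A.mulVec y i ≤ specNorm A * r ^ 2 := by
  have h1 := Finset.sum_mul_sq_le_sq_mul_sq Finset.univ x (A.mulVec y)
  have h2 := sum_sq_mulVec_le A y
  rw [hy] at h2
  rw [hx] at h1
  have h0 := specNorm_nonneg A
  refine le_of_sq_le_sq ?_ (by positivity)
  calc _ ≤ _ := h1
    _ ≤ r ^ 2 * (specNorm A ^ 2 * r ^ 2) := by gcongr
    _ = _ := by ring

lemma specNorm_vecMulVec_le {p : ℕ} (x y : Fin p → ℝ) {r : ℝ}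
    (hx : ∑ i, x i ^ 2 = r ^ 2) (hy : ∑ j, y j ^ 2 = r ^ 2) :
    specNorm (Matrix.vecMulVec x y) ≤ r ^ 2 := by
  refine ContinuousLinearMap.opNorm_le_bound _ (by positivity) fun z => ?_
  refine le_of_sq_le_sq ?_ (by positivity)
  have e : ‖(LinearMap.toContinuousLinearMap (Matrix.toEuclideanLin (Matrix.vecMulVec x y))) z‖ ^ 2
      = ∑ i, (Matrix.vecMulVec x y).mulVec z.ofLp i ^ 2 := by
    rw [← norm_toLp_sq]; rfl
  have hz : ‖z‖ ^ 2 = ∑ j, z.ofLp j ^ 2 := by rw [← norm_toLp_sq]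
  rw [e, mul_pow, hz]
  have h1 : ∀ i, (Matrix.vecMulVec x y).mulVec z.ofLp i = x i * ∑ j, y j * z.ofLp j := by
    intro i
    simp [Matrix.mulVec, dotProduct, Matrix.vecMulVec_apply, Finset.mul_sum, mul_assoc]
  simp_rw [h1, mul_pow]
  rw [← Finset.sum_mul, hx]
  have h2 := Finset.sum_mul_sq_le_sq_mul_sq Finset.univ y z.ofLp
  rw [hy] at h2
  calc _ ≤ r ^ 2 * (r ^ 2 * ∑ j, z.ofLp j ^ 2) := by gcongr
    _ = _ := by ring

lemma sum_sq_col_le_specNorm_fromCols {p K : ℕ} (B1 B2 : Matrix (Fin p) (Fin K) ℝ) (k : Fin K) :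
    ∑ j, B1 j k ^ 2 ≤ specNorm (Matrix.fromCols B1 B2) ^ 2 := by
  have h := sum_sq_mulVec_le (Matrix.fromCols B1 B2) (Pi.single (Sum.inl k) 1)
  simpa [Matrix.mulVec_single, Pi.single_apply] using h

lemma abs_bilin_sub_rankOne_le {p : ℕ} (A : Matrix (Fin p) (Fin p) ℝ) {b1 b2 x y : Fin p → ℝ}
    {e t : ℝ} (he0 : 0 ≤ e) (hA : frobSq (A - Matrix.vecMulVec b1 b2) ≤ e ^ 2)
    (hx : ∑ j, x j ^ 2 = t ^ 2) (hy : ∑ j, y j ^ 2 = t ^ 2) :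
    |∑ j, x j * A.mulVec y j - (∑ j, b1 j * x j) * ∑ j, b2 j * y j| ≤ e * t ^ 2 := by
  refine abs_le_of_sq_le_sq ?_ (by positivity)
  have e1 : ∑ j, x j * A.mulVec y j - (∑ j, b1 j * x j) * ∑ j, b2 j * y j
      = ∑ q : Fin p × Fin p, (A - Matrix.vecMulVec b1 b2) q.1 q.2 * (x q.1 * y q.2) := by
    rw [Fintype.sum_prod_type, Finset.sum_mul_sum, ← Finset.sum_sub_distrib]
    refine Finset.sum_congr rfl fun i _ => ?_
    rw [Matrix.mulVec, dotProduct, Finset.mul_sum, ← Finset.sum_sub_distrib]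
    refine Finset.sum_congr rfl fun j _ => ?_
    rw [Matrix.sub_apply, Matrix.vecMulVec_apply]; ring
  rw [e1]
  refine (Finset.sum_mul_sq_le_sq_mul_sq _ _ _).trans ?_
  have e2 : ∑ q : Fin p × Fin p, (x q.1 * y q.2) ^ 2 = t ^ 2 * t ^ 2 := by
    simp_rw [mul_pow, Fintype.sum_prod_type, ← Finset.mul_sum, hy, ← Finset.sum_mul, hx]
  rw [e2, Fintype.sum_prod_type]
  calc _ ≤ e ^ 2 * (t ^ 2 * t ^ 2) := by gcongr; exact hA
    _ = _ := by ring

lemma sum_sq_lin_comb {p : ℕ} {x y : Fin p → ℝ} {r : ℝ} (α β : ℝ)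
    (hx : ∑ j, x j ^ 2 = 1) (hy : ∑ j, y j ^ 2 = r ^ 2) :
    ∑ j, (α * x j + β * y j) ^ 2
      = α ^ 2 + 2 * α * β * (∑ j, y j * x j) + β ^ 2 * r ^ 2 := by
  have : ∀ j, (α * x j + β * y j) ^ 2
      = α ^ 2 * x j ^ 2 + 2 * α * β * (y j * x j) + β ^ 2 * y j ^ 2 := fun j => by ring
  simp_rw [this, Finset.sum_add_distrib, ← Finset.mul_sum, hx, hy]
  ring

/-- A unit vector nearly opposite to a nonnegative vector has a negative sum of entries. -/
lemma sum_neg_of_nearly_opposite {p : ℕ} {x y : Fin p → ℝ} {r e : ℝ} (hr : 0 < r)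
    (hx : ∑ j, x j ^ 2 = 1) (hy : ∑ j, y j ^ 2 = r ^ 2) (hy0 : ∀ j, 0 ≤ y j)
    (hc : r * ∑ j, y j * x j ≤ -(r ^ 2 - 2 * e)) (hep : 4 * (p * e) < r ^ 2) :
    ∑ j, x j < 0 := by
  have q1 := sum_sq_lin_comb r 1 hx hy
  have q2 := sq_sum_le_card_mul_sum_sq (s := Finset.univ) (f := fun j => r * x j + 1 * y j)
  rw [q1] at q2
  have q3 : r ≤ ∑ j, y j := by
    refine le_of_sq_le_sq ?_ (Finset.sum_nonneg fun j _ => hy0 j)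
    rw [← hy]
    exact Finset.sum_sq_le_sq_sum_of_nonneg fun j _ => hy0 j
  by_contra hx0
  push Not at hx0
  have q4 : r ≤ ∑ j, (r * x j + 1 * y j) := by
    rw [Finset.sum_add_distrib, ← Finset.mul_sum, ← Finset.mul_sum]
    linarith [mul_nonneg hr.le hx0]
  have q5 : r ^ 2 ≤ (∑ j, (r * x j + 1 * y j)) ^ 2 := by gcongr
  have q6 : (p : ℝ) * (r ^ 2 + 2 * r * 1 * (∑ j, y j * x j) + 1 ^ 2 * r ^ 2) ≤ p * (4 * e) := by
    gcongr; linarith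
  simp only [Finset.card_univ, Fintype.card_fin] at q2
  linarith

/-- With `sv` and `c` near `r²` and `r`, this is the lower bound on the cross term in
`‖√sv u - b‖²`. -/
lemma sqrt_mul_lower {r e sv c : ℝ} (hr : 0 < r) (he0 : 0 ≤ e) (he : 4 * e ≤ r ^ 2)
    (hsv : r ^ 2 - e ≤ sv) (hc : r ^ 2 - 2 * e ≤ r * c) : r ^ 2 - 3 * e ≤ √sv * c := by
  have hr2 : 0 < r ^ 2 := by positivity
  have hsq : √sv ^ 2 = sv := Real.sq_sqrt (by linarith)
  have hs0 : 0 ≤ √sv := Real.sqrt_nonneg _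
  have hrs : r ^ 2 - e ≤ r * √sv := by
    rcases le_total r (√sv) with h | h
    · linarith [mul_le_mul_of_nonneg_left h hr.le, sq r]
    · linarith [mul_le_mul_of_nonneg_right h hs0, sq (√sv)]
  have t1 : (r ^ 2 - e) * (r ^ 2 - 2 * e) ≤ (r * √sv) * (r * c) :=
    mul_le_mul hrs hc (by linarith) (by positivity)
  have t2 : (r ^ 2 - 3 * e) * r ^ 2 ≤ (√sv * c) * r ^ 2 := by
    linarith [mul_nonneg he0 he0, show (r * √sv) * (r * c) = (√sv * c) * r ^ 2 by ring,
      show (r ^ 2 - e) * (r ^ 2 - 2 * e) = (r ^ 2 - 3 * e) * r ^ 2 + 2 * (e * e) by ring]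
  exact le_of_mul_le_mul_right t2 hr2

/-- A top singular pair of a matrix close to a balanced nonnegative rank-one matrix `b₁ b₂ᵀ`,
with the sign pointing to the nonnegative side, is close to `(b₁, b₂)` after rescaling by the square
root of the singular value. -/
lemma IsTopSVD.close {p : ℕ} {A : Matrix (Fin p) (Fin p) ℝ} {u v b1 b2 : Fin p → ℝ} {sv r e : ℝ}
    (h : IsTopSVD A u sv v) (hr : 0 < r) (he0 : 0 ≤ e) (hb1 : ∀ j, 0 ≤ b1 j) (hb2 : ∀ j, 0 ≤ b2 j)
    (h1 : ∑ j, b1 j ^ 2 = r ^ 2) (h2 : ∑ j, b2 j ^ 2 = r ^ 2) (hsign : 0 ≤ ∑ j, (u j + v j))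
    (hA : frobSq (A - Matrix.vecMulVec b1 b2) ≤ e ^ 2)
    (he : 4 * e ≤ r ^ 2) (hep : 4 * (p * e) < r ^ 2) :
    ∑ j, (√sv * u j - b1 j) ^ 2 ≤ 7 * e ∧ ∑ j, (√sv * v j - b2 j) ^ 2 ≤ 7 * e := by
  obtain ⟨hu, hv, hsv, hAv, -⟩ := h
  have k1 := abs_bilin_sub_rankOne_le A he0 hA (x := u) (y := v) (t := 1)
    (by simpa using hu) (by simpa using hv)
  have k2 := abs_bilin_sub_rankOne_le A he0 hA h1 h2
  have k3 := sum_mul_mulVec_le A b1 b2 h1 h2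
  rw [← hsv] at k3
  have e3 : ∑ j, u j * A.mulVec v j = sv := by
    rw [hAv]
    calc _ = sv * ∑ j, u j ^ 2 := by
          rw [Finset.mul_sum]; exact Finset.sum_congr rfl fun j _ => by simp; ring
      _ = sv := by rw [hu, mul_one]
  have e4 : ∑ j, b1 j * b1 j = r ^ 2 := by rw [← h1]; simp_rw [sq]
  have e5 : ∑ j, b2 j * b2 j = r ^ 2 := by rw [← h2]; simp_rw [sq]
  rw [e3] at k1
  rw [e4, e5] at k2
  have X1 := fun α => sum_sq_lin_comb α (-1) hu h1
  have X2 := fun α => sum_sq_lin_comb α (-1) hv h2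
  have N1 := fun hc => sum_neg_of_nearly_opposite hr hu h1 hb1 hc hep
  have N2 := fun hc => sum_neg_of_nearly_opposite hr hv h2 hb2 hc hep
  have ha2 : |∑ j, b1 j * u j| ≤ r := by
    refine abs_le_of_sq_le_sq ?_ hr.le
    simpa [h1, hu] using Finset.sum_mul_sq_le_sq_mul_sq Finset.univ b1 u
  have hb2' : |∑ j, b2 j * v j| ≤ r := by
    refine abs_le_of_sq_le_sq ?_ hr.le
    simpa [h2, hv] using Finset.sum_mul_sq_le_sq_mul_sq Finset.univ b2 v
  generalize (∑ j, b1 j * u j) = a at *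
  generalize (∑ j, b2 j * v j) = b at *
  rw [abs_le] at k1 k2 ha2 hb2'
  have hr2 : 0 < r ^ 2 := by positivity
  have hlow : r ^ 2 - e ≤ sv := le_of_mul_le_mul_right (by linarith [k2.1]) hr2
  have hab : r ^ 2 - 2 * e ≤ a * b := by linarith [k1.2]
  have hup : sv ≤ a * b + e := by linarith [k1.2]
  have hpos : 0 < a ∧ 0 < b := by
    rcases pos_and_pos_or_neg_and_neg_of_mul_pos (show 0 < a * b by linarith) with h | ⟨ha, hb⟩
    · exact h
    · have s1 := N1 (by linarith [mul_nonneg (neg_pos.2 ha).le (sub_nonneg.2 (neg_le.1 hb2'.1))])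
      have s2 := N2 (by linarith [mul_nonneg (neg_pos.2 hb).le (sub_nonneg.2 (neg_le.1 ha2.1))])
      rw [Finset.sum_add_distrib] at hsign
      linarith
  obtain ⟨ha0, hb0⟩ := hpos
  have hsq : √sv ^ 2 = sv := Real.sq_sqrt (by linarith)
  have hra : r ^ 2 - 2 * e ≤ r * a := by linarith [mul_nonneg ha0.le (sub_nonneg.2 hb2'.2)]
  have hrb : r ^ 2 - 2 * e ≤ r * b := by linarith [mul_nonneg hb0.le (sub_nonneg.2 ha2.2)]
  have habr : a * b ≤ r ^ 2 := by
    rw [sq]; exact mul_le_mul ha2.2 hb2'.2 hb0.le hr.le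
  constructor
  · calc _ = _ := Finset.sum_congr rfl fun j _ => by ring
      _ = _ := X1 (√sv)
      _ ≤ _ := by linarith [sqrt_mul_lower hr he0 he hlow hra]
  · calc _ = _ := Finset.sum_congr rfl fun j _ => by ring
      _ = _ := X2 (√sv)
      _ ≤ _ := by linarith [sqrt_mul_lower hr he0 he hlow hrb]

/-! ### Averages over the observations and the topic condition -/

/-- The average of a sequence over its first `n` terms (zero when `n = 0`). -/
noncomputable def avg (n : ℕ) (f : ℕ → ℝ) : ℝ := 1 / (n : ℝ) * ∑ i ∈ Finset.range n, f i

lemma avg_add (n : ℕ) (f g : ℕ → ℝ) : avg n (fun i => f i + g i) = avg n f + avg n g := by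
  simp [avg, Finset.sum_add_distrib, mul_add]

lemma avg_sub (n : ℕ) (f g : ℕ → ℝ) : avg n (fun i => f i - g i) = avg n f - avg n g := by
  simp [avg, Finset.sum_sub_distrib, mul_sub]

lemma avg_mul_left (n : ℕ) (c : ℝ) (f : ℕ → ℝ) : avg n (fun i => c * f i) = c * avg n f := by
  simp only [avg, ← Finset.mul_sum]; ring

lemma avg_mul_right (n : ℕ) (c : ℝ) (f : ℕ → ℝ) : avg n (fun i => f i * c) = avg n f * c := by
  simp only [avg, ← Finset.sum_mul]; ring

lemma avg_sum {ι : Type*} (t : Finset ι) (n : ℕ) (f : ι → ℕ → ℝ) :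
    avg n (fun i => ∑ a ∈ t, f a i) = ∑ a ∈ t, avg n (f a) := by
  simp only [avg, ← Finset.mul_sum]
  rw [Finset.sum_comm]

lemma avg_mono {n : ℕ} {f g : ℕ → ℝ} (h : ∀ i, f i ≤ g i) : avg n f ≤ avg n g := by
  unfold avg
  gcongr
  exact h _

lemma avg_const_le {n : ℕ} {c : ℝ} (hc : 0 ≤ c) : avg n (fun _ => c) ≤ c := by
  unfold avg
  rcases Nat.eq_zero_or_pos n with rfl | h
  · simpa using hc
  · have : (n : ℝ) ≠ 0 := by positivity
    simp [this]

lemma abs_avg_le {n : ℕ} {f : ℕ → ℝ} {c : ℝ} (hc : 0 ≤ c) (h : ∀ i, |f i| ≤ c) :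
    |avg n f| ≤ c := by
  refine le_trans ?_ (avg_const_le (n := n) hc)
  unfold avg
  rw [abs_mul, abs_of_nonneg (by positivity : (0 : ℝ) ≤ 1 / n)]
  gcongr
  exact (Finset.abs_sum_le_sum_abs _ _).trans (Finset.sum_le_sum fun i _ => h i)

lemma avg_nonneg {n : ℕ} {f : ℕ → ℝ} (h : ∀ i, 0 ≤ f i) : 0 ≤ avg n f := by
  unfold avg
  exact mul_nonneg (by positivity) (Finset.sum_nonneg fun i _ => h i)

section Weights

variable {K : ℕ} {w : Fin K → ℝ}

lemma weight_le_one (h0 : ∀ k, 0 ≤ w k) (h1 : ∑ k, w k = 1) (k : Fin K) : w k ≤ 1 :=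
  h1 ▸ Finset.single_le_sum (fun k _ => h0 k) (Finset.mem_univ k)

lemma abs_sum_weight_mul_le (h0 : ∀ k, 0 ≤ w k) (h1 : ∑ k, w k = 1) {x : Fin K → ℝ} {c : ℝ}
    (hx : ∀ k, |x k| ≤ c) : |∑ k, w k * x k| ≤ c := by
  calc _ ≤ ∑ k, |w k * x k| := Finset.abs_sum_le_sum_abs _ _
    _ ≤ ∑ k, w k * c := Finset.sum_le_sum fun k _ => by
        rw [abs_mul, abs_of_nonneg (h0 k)]; exact mul_le_mul_of_nonneg_left (hx k) (h0 k)
    _ = c := by rw [← Finset.sum_mul, h1, one_mul]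

lemma sq_sum_weight_mul_le (h0 : ∀ k, 0 ≤ w k) (h1 : ∑ k, w k = 1) (x : Fin K → ℝ) :
    (∑ k, w k * x k) ^ 2 ≤ ∑ k, x k ^ 2 := by
  have h2 : ∑ k, w k ^ 2 ≤ 1 := h1 ▸ Finset.sum_le_sum fun k _ => by
    rw [sq]; exact mul_le_of_le_one_left (h0 k) (weight_le_one h0 h1 k)
  calc _ ≤ _ := Finset.sum_mul_sq_le_sq_mul_sq Finset.univ w x
    _ ≤ _ := mul_le_of_le_one_left (Finset.sum_nonneg fun k _ => sq_nonneg _) h2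

end Weights

/-- The topic condition bounds the topic quadratic form from below. -/
lemma TopicCondition.le_avg {K n : ℕ} {μ : ℝ} {m : ℕ → Fin K → ℝ} (h : TopicCondition μ n m)
    (x : Fin K → ℝ) : μ * ∑ k, x k ^ 2 ≤ avg n fun i => (∑ k, m i k * x k) ^ 2 := by
  have h1 := h.dotProduct_mulVec_nonneg x
  rw [Matrix.sub_mulVec, dotProduct_sub, Matrix.smul_mulVec, Matrix.one_mulVec,
    dotProduct_smul, sub_nonneg] at h1
  have e1 : μ • (star x ⬝ᵥ x) = μ * ∑ k, x k ^ 2 := by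
    simp [dotProduct, sq]
  have e2 : star x ⬝ᵥ (topicGram n m).mulVec x = avg n fun i => (∑ k, m i k * x k) ^ 2 := by
    have : ∀ i, (∑ k, m i k * x k) ^ 2 = ∑ k, ∑ l, x k * x l * (m i k * m i l) := by
      intro i
      rw [sq, Finset.sum_mul_sum]
      exact Finset.sum_congr rfl fun k _ => Finset.sum_congr rfl fun l _ => by ring
    simp_rw [this, avg_sum, avg_mul_left]
    simp only [dotProduct, Matrix.mulVec, Finset.mul_sum, topicGram, Matrix.of_apply, avg]
    refine Finset.sum_congr rfl fun k _ => Finset.sum_congr rfl fun l _ => ?_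
    rw [Finset.sum_mul, Finset.mul_sum]
    exact Finset.sum_congr rfl fun i _ => by rw [Pi.star_apply, star_trivial]; ring
  rwa [e1, e2] at h1

/-! ### Gradients of the loss and of the regularizer -/

section Gradients

variable {p K : ℕ}

lemma mul_diagonal_mul_transpose_apply (B1 B2 : Matrix (Fin p) (Fin K) ℝ) (w : Fin K → ℝ)
    (j l : Fin p) :
    (B1 * Matrix.diagonal w * B2.transpose) j l = ∑ k, w k * (B1 j k * B2 l k) := by
  rw [Matrix.mul_apply]
  exact Finset.sum_congr rfl fun k _ => by
    rw [Matrix.mul_diagonal, Matrix.transpose_apply]; ring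

lemma matGrad_loss_left (n : ℕ) (m : ℕ → Fin K → ℝ) (X : ℕ → Matrix (Fin p) (Fin p) ℝ)
    (B1 B2 : Matrix (Fin p) (Fin K) ℝ) (j : Fin p) (k : Fin K) :
    matGrad (fun Z => loss n m X Z B2) B1 j k
      = -avg n fun i => m i k *
          ∑ l, (X i - B1 * Matrix.diagonal (m i) * B2.transpose) j l * B2 l k := by
  have key : ∀ i : ℕ, HasDerivAt (fun t : ℝ => frobSq (X i -
      (B1 + t • Matrix.single j k (1 : ℝ)) * Matrix.diagonal (m i) * B2.transpose))
      (-2 * (m i k * ∑ l, (X i - B1 * Matrix.diagonal (m i) * B2.transpose) j l * B2 l k)) 0 := by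
    intro i
    set R := X i - B1 * Matrix.diagonal (m i) * B2.transpose with hR
    have e : ∀ t : ℝ, ∀ a b, (X i -
        (B1 + t • Matrix.single j k (1 : ℝ)) * Matrix.diagonal (m i) * B2.transpose) a b
        = R a b - t * (if a = j then m i k * B2 b k else 0) := by
      intro t a b
      rw [hR, Matrix.sub_apply, Matrix.sub_apply, mul_diagonal_mul_transpose_apply,
        mul_diagonal_mul_transpose_apply, sub_sub]
      congr 1
      rw [show t * (if a = j then m i k * B2 b k else 0)
        = ∑ k', m i k' * ((t • Matrix.single j k (1 : ℝ)) a k' * B2 b k') by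
          split_ifs with h
          · subst h
            rw [Finset.sum_eq_single k]
            · simp; ring
            · intro k' _ hk'; simp [hk'.symm]
            · simp
          · simp [Ne.symm h]]
      rw [← Finset.sum_add_distrib]
      exact Finset.sum_congr rfl fun k' _ => by rw [Matrix.add_apply]; ring
    have e' : (fun t : ℝ => frobSq (X i -
        (B1 + t • Matrix.single j k (1 : ℝ)) * Matrix.diagonal (m i) * B2.transpose))
        = fun t => ∑ a, ∑ b, (R a b - t * (if a = j then m i k * B2 b k else 0)) ^ 2 := by
      funext t
      simp only [frobSq, e]
    rw [e']
    have hd : HasDerivAt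
        (fun t => ∑ a, ∑ b, (R a b - t * (if a = j then m i k * B2 b k else 0)) ^ 2)
        (∑ a, ∑ b, -2 * (R a b * (if a = j then m i k * B2 b k else 0))) 0 := by
      refine HasDerivAt.fun_sum fun a _ => HasDerivAt.fun_sum fun b _ => ?_
      have := (((hasDerivAt_id (0 : ℝ)).mul_const
        (if a = j then m i k * B2 b k else 0)).const_sub (R a b)).pow 2
      exact this.congr_deriv (by simp only [id]; push_cast; ring)
    refine hd.congr_deriv ?_
    have h0 : ∀ a, a ≠ j →
        ∑ b, -2 * (R a b * (if a = j then m i k * B2 b k else 0)) = 0 := fun a ha => by simp [ha]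
    rw [Fintype.sum_eq_single j h0]
    simp only [if_true, Finset.mul_sum]
    exact Finset.sum_congr rfl fun b _ => by ring
  have h2 := (HasDerivAt.fun_sum fun i (_ : i ∈ Finset.range n) => key i).const_mul
    (1 / (2 * (n : ℝ)))
  rw [matGrad, Matrix.of_apply]
  simp only [loss]
  rw [h2.deriv, avg, ← Finset.mul_sum]
  rcases Nat.eq_zero_or_pos n with rfl | hn
  · simp
  · field_simp

lemma frobSq_transpose {a b : ℕ} (A : Matrix (Fin a) (Fin b) ℝ) :
    frobSq A.transpose = frobSq A := by
  unfold frobSq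
  rw [Finset.sum_comm]
  rfl

lemma loss_swap (n : ℕ) (m : ℕ → Fin K → ℝ) (X : ℕ → Matrix (Fin p) (Fin p) ℝ)
    (B1 B2 : Matrix (Fin p) (Fin K) ℝ) :
    loss n m X B1 B2 = loss n m (fun i => (X i).transpose) B2 B1 := by
  unfold loss
  congr 1
  refine Finset.sum_congr rfl fun i _ => ?_
  rw [← frobSq_transpose]
  simp [Matrix.transpose_mul, Matrix.mul_assoc]

lemma balReg_swap (lam : ℝ) (B1 B2 : Matrix (Fin p) (Fin K) ℝ) :
    balReg lam B1 B2 = balReg lam B2 B1 := by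
  unfold balReg
  congr 1
  exact Finset.sum_congr rfl fun k _ => by ring

lemma matGrad_balReg_left (lam : ℝ) (B1 B2 : Matrix (Fin p) (Fin K) ℝ) (j : Fin p) (k : Fin K) :
    matGrad (fun Z => balReg lam Z B2) B1 j k
      = 2 * lam * ((∑ a, B1 a k ^ 2) - ∑ a, B2 a k ^ 2) * B1 j k := by
  rw [matGrad, Matrix.of_apply]
  simp only [balReg]
  have h1 : ∀ a k', HasDerivAt (fun t : ℝ => (B1 + t • Matrix.single j k (1 : ℝ)) a k' ^ 2)
      (2 * B1 a k' * (Matrix.single j k (1 : ℝ)) a k') 0 := by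
    intro a k'
    have := (((hasDerivAt_id (0 : ℝ)).mul_const
        ((Matrix.single j k (1 : ℝ)) a k')).const_add (B1 a k')).pow 2
    exact this.congr_deriv (by simp)
  have h2 : ∀ k', HasDerivAt (fun t : ℝ =>
      ((∑ a, (B1 + t • Matrix.single j k (1 : ℝ)) a k' ^ 2) - ∑ a, B2 a k' ^ 2) ^ 2)
      (2 * ((∑ a, B1 a k' ^ 2) - ∑ a, B2 a k' ^ 2)
        * ∑ a, 2 * B1 a k' * (Matrix.single j k (1 : ℝ)) a k') 0 := by
    intro k'
    have := ((HasDerivAt.fun_sum fun a (_ : a ∈ Finset.univ) => h1 a k').sub_const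
      (∑ a, B2 a k' ^ 2)).pow 2
    exact this.congr_deriv (by simp)
  have h3 := (HasDerivAt.fun_sum fun k' (_ : k' ∈ Finset.univ) => h2 k').const_mul (lam / 2)
  have h0 : ∀ k', k' ≠ k → 2 * ((∑ a, B1 a k' ^ 2) - ∑ a, B2 a k' ^ 2)
      * ∑ a, 2 * B1 a k' * (Matrix.single j k (1 : ℝ)) a k' = 0 := fun k' hk' => by
    simp [hk'.symm]
  have h0' : ∀ a, a ≠ j → 2 * B1 a k * (Matrix.single j k (1 : ℝ)) a k = 0 := fun a ha => by
    simp [ha.symm]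
  rw [h3.deriv, Fintype.sum_eq_single k h0, Fintype.sum_eq_single j h0', Matrix.single_apply_same]
  ring

end Gradients

/-! ### The Hessian of the noise-free objective at the truth -/

section Hessian

variable {p K : ℕ}

/-- The derivative at `(b₁, b₂)`, in the direction `(D₁, D₂)`, of the `(j, l)` entry of
`B₁ M_i B₂ᵀ`. -/
def linPred (m : ℕ → Fin K → ℝ) (b1 b2 D1 D2 : Matrix (Fin p) (Fin K) ℝ) (i : ℕ) (j l : Fin p) :
    ℝ := ∑ k, m i k * (D1 j k * b2 l k + b1 j k * D2 l k)

/-- Half the derivative at `(b₁, b₂)`, in the direction `(D₁, D₂)`, of the imbalance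
`‖b_k¹‖² - ‖b_k²‖²`. -/
def linBal (b1 b2 D1 D2 : Matrix (Fin p) (Fin K) ℝ) (k : Fin K) : ℝ :=
  ∑ j, b1 j k * D1 j k - ∑ j, b2 j k * D2 j k

/-- The first block of the Hessian of the noise-free objective at a balanced pair `(b₁, b₂)`,
applied to `(D₁, D₂)`. The second block is obtained by swapping the indices `1` and `2`. -/
noncomputable def hessBlock (n : ℕ) (m : ℕ → Fin K → ℝ) (lam : ℝ)
    (b1 b2 D1 D2 : Matrix (Fin p) (Fin K) ℝ) : Matrix (Fin p) (Fin K) ℝ :=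
  Matrix.of fun j k => (avg n fun i => m i k * ∑ l, linPred m b1 b2 D1 D2 i j l * b2 l k)
    + 4 * lam * linBal b1 b2 D1 D2 k * b1 j k

/-- The bilinear form of the Hessian of the noise-free objective at a balanced pair `(b₁, b₂)`. -/
noncomputable def hessForm (n : ℕ) (m : ℕ → Fin K → ℝ) (lam : ℝ)
    (b1 b2 D1 D2 V1 V2 : Matrix (Fin p) (Fin K) ℝ) : ℝ :=
  (avg n fun i => ∑ j, ∑ l, linPred m b1 b2 D1 D2 i j l * linPred m b1 b2 V1 V2 i j l)
    + 4 * lam * ∑ k, linBal b1 b2 D1 D2 k * linBal b1 b2 V1 V2 k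

lemma linPred_swap (m : ℕ → Fin K → ℝ) (b1 b2 D1 D2 : Matrix (Fin p) (Fin K) ℝ) (i : ℕ)
    (j l : Fin p) : linPred m b2 b1 D2 D1 i j l = linPred m b1 b2 D1 D2 i l j :=
  Finset.sum_congr rfl fun k _ => by ring

lemma linBal_swap (b1 b2 D1 D2 : Matrix (Fin p) (Fin K) ℝ) (k : Fin K) :
    linBal b2 b1 D2 D1 k = -linBal b1 b2 D1 D2 k := by
  unfold linBal; ring

lemma linPred_sub_smul (m : ℕ → Fin K → ℝ) (b1 b2 D1 D2 V1 V2 : Matrix (Fin p) (Fin K) ℝ) (t : ℝ)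
    (i : ℕ) (j l : Fin p) : linPred m b1 b2 (D1 - t • V1) (D2 - t • V2) i j l
      = linPred m b1 b2 D1 D2 i j l - t * linPred m b1 b2 V1 V2 i j l := by
  unfold linPred
  rw [Finset.mul_sum, ← Finset.sum_sub_distrib]
  exact Finset.sum_congr rfl fun k _ => by
    simp only [Matrix.sub_apply, Matrix.smul_apply, smul_eq_mul]; ring

lemma linBal_sub_smul (b1 b2 D1 D2 V1 V2 : Matrix (Fin p) (Fin K) ℝ) (t : ℝ) (k : Fin K) :
    linBal b1 b2 (D1 - t • V1) (D2 - t • V2) k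
      = linBal b1 b2 D1 D2 k - t * linBal b1 b2 V1 V2 k := by
  have : ∀ b D V : Matrix (Fin p) (Fin K) ℝ, ∑ j, b j k * (D - t • V) j k
      = ∑ j, b j k * D j k - t * ∑ j, b j k * V j k := by
    intro b D V
    rw [Finset.mul_sum, ← Finset.sum_sub_distrib]
    exact Finset.sum_congr rfl fun k _ => by
      simp only [Matrix.sub_apply, Matrix.smul_apply, smul_eq_mul]; ring
  unfold linBal
  rw [this, this]; ring

/-- The adjoint of `V ↦ (∑_k m_ik V_jk b_lk)`, averaged over the observations. -/
lemma sum_avg_mul_eq (n : ℕ) (m : ℕ → Fin K → ℝ) (Y : ℕ → Fin p → Fin p → ℝ)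
    (b V : Matrix (Fin p) (Fin K) ℝ) :
    ∑ j, ∑ k, (avg n fun i => m i k * ∑ l, Y i j l * b l k) * V j k
      = avg n fun i => ∑ j, ∑ l, Y i j l * ∑ k, m i k * (V j k * b l k) := by
  rw [avg_sum]
  refine Finset.sum_congr rfl fun j _ => ?_
  simp_rw [← avg_mul_right, ← avg_sum]
  congr 1
  funext i
  simp_rw [Finset.mul_sum, Finset.sum_mul]
  rw [Finset.sum_comm]
  exact Finset.sum_congr rfl fun l _ => Finset.sum_congr rfl fun k _ => by ring

/-- `hessForm` is the bilinear form of the operator with blocks `hessBlock`. -/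
lemma sum_hessBlock_mul (n : ℕ) (m : ℕ → Fin K → ℝ) (lam : ℝ)
    (b1 b2 D1 D2 V1 V2 : Matrix (Fin p) (Fin K) ℝ) :
    (∑ j, ∑ k, hessBlock n m lam b1 b2 D1 D2 j k * V1 j k)
      + ∑ j, ∑ k, hessBlock n m lam b2 b1 D2 D1 j k * V2 j k
      = hessForm n m lam b1 b2 D1 D2 V1 V2 := by
  have hz : ∀ (z : Fin K → ℝ) (b V : Matrix (Fin p) (Fin K) ℝ),
      ∑ j, ∑ k, 4 * lam * z k * b j k * V j k = 4 * lam * ∑ k, z k * ∑ j, b j k * V j k := by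
    intro z b V
    rw [Finset.sum_comm, Finset.mul_sum]
    refine Finset.sum_congr rfl fun k _ => ?_
    rw [Finset.mul_sum, Finset.mul_sum]
    exact Finset.sum_congr rfl fun j _ => by ring
  simp only [hessBlock, Matrix.of_apply, add_mul, Finset.sum_add_distrib, hz]
  rw [sum_avg_mul_eq n m (linPred m b1 b2 D1 D2), sum_avg_mul_eq n m (linPred m b2 b1 D2 D1)]
  have e1 : (fun i => ∑ j, ∑ l, linPred m b2 b1 D2 D1 i j l * ∑ k, m i k * (V2 j k * b1 l k))
      = fun i => ∑ j, ∑ l, linPred m b1 b2 D1 D2 i j l * ∑ k, m i k * (b1 j k * V2 l k) := by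
    funext i
    rw [Finset.sum_comm]
    refine Finset.sum_congr rfl fun l _ => Finset.sum_congr rfl fun j _ => ?_
    rw [linPred_swap]
    congr 1
    exact Finset.sum_congr rfl fun k _ => by ring
  rw [e1, hessForm]
  have e2 : ∀ i, ∑ j, ∑ l, linPred m b1 b2 D1 D2 i j l * linPred m b1 b2 V1 V2 i j l
      = (∑ j, ∑ l, linPred m b1 b2 D1 D2 i j l * ∑ k, m i k * (V1 j k * b2 l k))
        + ∑ j, ∑ l, linPred m b1 b2 D1 D2 i j l * ∑ k, m i k * (b1 j k * V2 l k) := by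
    intro i
    rw [← Finset.sum_add_distrib]
    refine Finset.sum_congr rfl fun j _ => ?_
    rw [← Finset.sum_add_distrib]
    refine Finset.sum_congr rfl fun l _ => ?_
    rw [← mul_add, ← Finset.sum_add_distrib, linPred]
    simp only [← mul_add]
    rfl
  simp_rw [e2, avg_add, linBal_swap b1 b2 D1 D2]
  have e3 : ∑ k, linBal b1 b2 D1 D2 k * linBal b1 b2 V1 V2 k
      = ∑ k, linBal b1 b2 D1 D2 k * ∑ j, b1 j k * V1 j k
        + ∑ k, -linBal b1 b2 D1 D2 k * ∑ j, b2 j k * V2 j k := by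
    rw [← Finset.sum_add_distrib]
    exact Finset.sum_congr rfl fun k _ => by rw [linBal, linBal]; ring
  rw [e3]; ring

lemma hessForm_self_nonneg {n : ℕ} {m : ℕ → Fin K → ℝ} {lam : ℝ} (hlam : 0 ≤ lam)
    (b1 b2 D1 D2 : Matrix (Fin p) (Fin K) ℝ) : 0 ≤ hessForm n m lam b1 b2 D1 D2 D1 D2 := by
  unfold hessForm
  refine add_nonneg (avg_nonneg fun i => Finset.sum_nonneg fun j _ => Finset.sum_nonneg fun l _ =>
    mul_self_nonneg _) (mul_nonneg (by positivity) (Finset.sum_nonneg fun k _ => mul_self_nonneg _))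

lemma hessForm_sub_smul (n : ℕ) (m : ℕ → Fin K → ℝ) (lam : ℝ)
    (b1 b2 D1 D2 V1 V2 : Matrix (Fin p) (Fin K) ℝ) (t : ℝ) :
    hessForm n m lam b1 b2 (D1 - t • V1) (D2 - t • V2) (D1 - t • V1) (D2 - t • V2)
      = hessForm n m lam b1 b2 D1 D2 D1 D2 - 2 * t * hessForm n m lam b1 b2 D1 D2 V1 V2
        + t ^ 2 * hessForm n m lam b1 b2 V1 V2 V1 V2 := by
  have ex : ∀ a b : ℝ, (a - t * b) * (a - t * b) = a * a - 2 * t * (a * b) + t ^ 2 * (b * b) :=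
    fun a b => by ring
  simp only [hessForm, linPred_sub_smul, linBal_sub_smul, ex, Finset.sum_add_distrib,
    Finset.sum_sub_distrib, ← Finset.mul_sum, avg_add, avg_sub, avg_mul_left]
  ring

lemma sum_sum_sq_rankTwo (x y u v : Fin p → ℝ) :
    ∑ j, ∑ l, (x j * v l + u j * y l) ^ 2
      = (∑ j, x j ^ 2) * (∑ l, v l ^ 2) + 2 * (∑ j, u j * x j) * (∑ l, v l * y l)
        + (∑ j, u j ^ 2) * ∑ l, y l ^ 2 := by
  have : ∀ j l, (x j * v l + u j * y l) ^ 2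
      = x j ^ 2 * v l ^ 2 + 2 * ((u j * x j) * (v l * y l)) + u j ^ 2 * y l ^ 2 :=
    fun j l => by ring
  simp_rw [this, Finset.sum_add_distrib, ← Finset.mul_sum, ← Finset.sum_mul]
  ring

lemma frobSq_eq_sum_col (D : Matrix (Fin p) (Fin K) ℝ) : frobSq D = ∑ k, ∑ j, D j k ^ 2 := by
  unfold frobSq
  exact Finset.sum_comm

lemma frobSq_nonneg {a b : ℕ} (A : Matrix (Fin a) (Fin b) ℝ) : 0 ≤ frobSq A :=
  Finset.sum_nonneg fun _ _ => Finset.sum_nonneg fun _ _ => sq_nonneg _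

variable {n : ℕ} {m : ℕ → Fin K → ℝ} {lam μ σ η : ℝ} {b1 b2 : Matrix (Fin p) (Fin K) ℝ}

lemma sum_entries_comm (F : Fin p → Fin p → Fin K → ℝ) :
    ∑ j, ∑ l, ∑ k, F j l k = ∑ k, ∑ j, ∑ l, F j l k :=
  (Finset.sum_congr rfl fun _ _ => Finset.sum_comm).trans Finset.sum_comm

/-- Local strong convexity: the topic condition controls the rank-two parts, and the balancing
regularizer controls the remaining scaling direction `(b_k¹, -b_k²)`. -/
lemma le_hessForm_self (hμ : 0 ≤ μ) (hlam : 0 ≤ lam) (hT : TopicCondition μ n m)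
    (hbal : ∀ k, ∑ j, b1 j k ^ 2 = ∑ j, b2 j k ^ 2) (hσ : ∀ k, σ ≤ ∑ j, b1 j k ^ 2)
    (D1 D2 : Matrix (Fin p) (Fin K) ℝ) :
    min μ (4 * lam) * σ * (frobSq D1 + frobSq D2) ≤ hessForm n m lam b1 b2 D1 D2 D1 D2 := by
  have h1 : μ * ∑ k, ∑ j, ∑ l, (D1 j k * b2 l k + b1 j k * D2 l k) ^ 2
      ≤ avg n fun i => ∑ j, ∑ l, linPred m b1 b2 D1 D2 i j l * linPred m b1 b2 D1 D2 i j l := by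
    rw [← sum_entries_comm, avg_sum, Finset.mul_sum]
    refine Finset.sum_le_sum fun j _ => ?_
    rw [avg_sum, Finset.mul_sum]
    refine Finset.sum_le_sum fun l _ => ?_
    simp_rw [← sq]
    exact hT.le_avg _
  have hν1 : min μ (4 * lam) ≤ μ := min_le_left _ _
  have hν2 : min μ (4 * lam) ≤ 4 * lam := min_le_right _ _
  have hν0 : 0 ≤ min μ (4 * lam) := le_min hμ (by positivity)
  generalize min μ (4 * lam) = ν at *
  unfold hessForm
  calc ν * σ * (frobSq D1 + frobSq D2)
      = ∑ k, ν * (σ * (∑ j, D1 j k ^ 2 + ∑ j, D2 j k ^ 2)) := by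
        rw [frobSq_eq_sum_col, frobSq_eq_sum_col, ← Finset.sum_add_distrib, Finset.mul_sum]
        exact Finset.sum_congr rfl fun k _ => by ring
    _ ≤ ∑ k, ν * ((∑ j, ∑ l, (D1 j k * b2 l k + b1 j k * D2 l k) ^ 2)
          + linBal b1 b2 D1 D2 k * linBal b1 b2 D1 D2 k) := by
        refine Finset.sum_le_sum fun k _ => mul_le_mul_of_nonneg_left ?_ hν0
        rw [sum_sum_sq_rankTwo (fun j => D1 j k) (fun j => D2 j k) (fun j => b1 j k)
          (fun j => b2 j k), ← hbal k, linBal]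
        have s1 : 0 ≤ ∑ j, D1 j k ^ 2 := Finset.sum_nonneg fun _ _ => sq_nonneg _
        have s2 : 0 ≤ ∑ j, D2 j k ^ 2 := Finset.sum_nonneg fun _ _ => sq_nonneg _
        have := mul_le_mul_of_nonneg_right (hσ k) (add_nonneg s1 s2)
        linarith [sq_nonneg (∑ j, b1 j k * D1 j k), sq_nonneg (∑ j, b2 j k * D2 j k)]
    _ = ν * (∑ k, ∑ j, ∑ l, (D1 j k * b2 l k + b1 j k * D2 l k) ^ 2)
          + ν * ∑ k, linBal b1 b2 D1 D2 k * linBal b1 b2 D1 D2 k := by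
        rw [← Finset.mul_sum, Finset.sum_add_distrib, mul_add]
    _ ≤ _ := by
        refine add_le_add (le_trans ?_ h1) ?_
        · exact mul_le_mul_of_nonneg_right hν1 (Finset.sum_nonneg fun _ _ =>
            Finset.sum_nonneg fun _ _ => Finset.sum_nonneg fun _ _ => sq_nonneg _)
        · exact mul_le_mul_of_nonneg_right hν2 (Finset.sum_nonneg fun _ _ => mul_self_nonneg _)

/-- Local smoothness, in the scale of the step size. -/
lemma mul_hessForm_self_le (hη : 0 ≤ η) (hlam : 0 ≤ lam) (hm0 : ∀ i k, 0 ≤ m i k)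
    (hm1 : ∀ i, ∑ k, m i k = 1) (hbal : ∀ k, ∑ j, b1 j k ^ 2 = ∑ j, b2 j k ^ 2)
    (hstep : ∀ k, η * (2 + 8 * lam) * ∑ j, b1 j k ^ 2 ≤ 1) (D1 D2 : Matrix (Fin p) (Fin K) ℝ) :
    η * hessForm n m lam b1 b2 D1 D2 D1 D2 ≤ frobSq D1 + frobSq D2 := by
  have h1 : (avg n fun i => ∑ j, ∑ l, linPred m b1 b2 D1 D2 i j l * linPred m b1 b2 D1 D2 i j l)
      ≤ ∑ k, ∑ j, ∑ l, (D1 j k * b2 l k + b1 j k * D2 l k) ^ 2 := by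
    refine (avg_mono fun i => ?_).trans (avg_const_le (Finset.sum_nonneg fun _ _ =>
      Finset.sum_nonneg fun _ _ => Finset.sum_nonneg fun _ _ => sq_nonneg _))
    rw [← sum_entries_comm]
    refine Finset.sum_le_sum fun j _ => Finset.sum_le_sum fun l _ => ?_
    rw [← sq]
    exact sq_sum_weight_mul_le (hm0 i) (hm1 i) _
  unfold hessForm
  calc _ ≤ η * ((∑ k, ∑ j, ∑ l, (D1 j k * b2 l k + b1 j k * D2 l k) ^ 2)
          + 4 * lam * ∑ k, linBal b1 b2 D1 D2 k * linBal b1 b2 D1 D2 k) := by gcongr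
    _ = ∑ k, η * ((∑ j, ∑ l, (D1 j k * b2 l k + b1 j k * D2 l k) ^ 2)
          + 4 * lam * (linBal b1 b2 D1 D2 k * linBal b1 b2 D1 D2 k)) := by
        rw [← Finset.mul_sum, Finset.sum_add_distrib, ← Finset.mul_sum]
    _ ≤ ∑ k, ((∑ j, D1 j k ^ 2) + ∑ j, D2 j k ^ 2) := by
        refine Finset.sum_le_sum fun k _ => ?_
        rw [sum_sum_sq_rankTwo (fun j => D1 j k) (fun j => D2 j k) (fun j => b1 j k)
          (fun j => b2 j k), linBal]
        have c1 := Finset.sum_mul_sq_le_sq_mul_sq Finset.univ (fun j => b1 j k) (fun j => D1 j k)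
        have c2 := Finset.sum_mul_sq_le_sq_mul_sq Finset.univ (fun j => b2 j k) (fun j => D2 j k)
        have h2 := hstep k
        have s1 : 0 ≤ ∑ j, D1 j k ^ 2 := Finset.sum_nonneg fun _ _ => sq_nonneg _
        have s2 : 0 ≤ ∑ j, D2 j k ^ 2 := Finset.sum_nonneg fun _ _ => sq_nonneg _
        rw [← hbal k] at c2 ⊢
        generalize (∑ j, D1 j k ^ 2) = A1 at *
        generalize (∑ j, D2 j k ^ 2) = A2 at *
        generalize (∑ j, b1 j k ^ 2) = r at *
        generalize (∑ j, b1 j k * D1 j k) = x at *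
        generalize (∑ j, b2 j k * D2 j k) = y at *
        have t1 : A1 * r + 2 * x * y + r * A2 + 4 * lam * ((x - y) * (x - y))
            ≤ (2 + 8 * lam) * r * (A1 + A2) := by
          have u1 : 2 * x * y ≤ r * A1 + r * A2 := by linarith [sq_nonneg (x - y)]
          have u2 : (x - y) * (x - y) ≤ 2 * (r * A1 + r * A2) := by linarith [sq_nonneg (x + y)]
          have u3 := mul_le_mul_of_nonneg_left u2 (by positivity : 0 ≤ 4 * lam)
          linarith
        calc _ ≤ η * ((2 + 8 * lam) * r * (A1 + A2)) := mul_le_mul_of_nonneg_left t1 hη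
          _ = η * (2 + 8 * lam) * r * (A1 + A2) := by ring
          _ ≤ 1 * (A1 + A2) := mul_le_mul_of_nonneg_right h2 (add_nonneg s1 s2)
          _ = _ := one_mul _
    _ = _ := by rw [Finset.sum_add_distrib, ← frobSq_eq_sum_col, ← frobSq_eq_sum_col]

lemma frobSq_sub_smul (D V : Matrix (Fin p) (Fin K) ℝ) (t : ℝ) :
    frobSq (D - t • V) = frobSq D - 2 * t * (∑ j, ∑ k, V j k * D j k) + t ^ 2 * frobSq V := by
  have : ∀ j k, (D - t • V) j k ^ 2 = D j k ^ 2 - 2 * t * (V j k * D j k) + t ^ 2 * V j k ^ 2 :=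
    fun j k => by simp only [Matrix.sub_apply, Matrix.smul_apply, smul_eq_mul]; ring
  simp only [frobSq, this, Finset.sum_add_distrib, Finset.sum_sub_distrib, ← Finset.mul_sum]

/-- One step of gradient descent for the linearized noise-free objective is a contraction. -/
lemma frobSq_linear_step_le (hη : 0 < η) (hμ : 0 ≤ μ) (hlam : 0 ≤ lam)
    (hT : TopicCondition μ n m) (hm0 : ∀ i k, 0 ≤ m i k) (hm1 : ∀ i, ∑ k, m i k = 1)
    (hbal : ∀ k, ∑ j, b1 j k ^ 2 = ∑ j, b2 j k ^ 2) (hσ : ∀ k, σ ≤ ∑ j, b1 j k ^ 2)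
    (hstep : ∀ k, η * (2 + 8 * lam) * ∑ j, b1 j k ^ 2 ≤ 1) (D1 D2 : Matrix (Fin p) (Fin K) ℝ) :
    frobSq (D1 - η • hessBlock n m lam b1 b2 D1 D2)
        + frobSq (D2 - η • hessBlock n m lam b2 b1 D2 D1)
      ≤ (1 - η * (min μ (4 * lam) * σ)) * (frobSq D1 + frobSq D2) := by
  have low := le_hessForm_self hμ hlam hT hbal hσ D1 D2
  set V1 := hessBlock n m lam b1 b2 D1 D2 with hV1
  set V2 := hessBlock n m lam b2 b1 D2 D1 with hV2
  have q1 : (∑ j, ∑ k, V1 j k * D1 j k) + ∑ j, ∑ k, V2 j k * D2 j k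
      = hessForm n m lam b1 b2 D1 D2 D1 D2 := sum_hessBlock_mul n m lam b1 b2 D1 D2 D1 D2
  have q2 : frobSq V1 + frobSq V2 = hessForm n m lam b1 b2 D1 D2 V1 V2 := by
    rw [← sum_hessBlock_mul]
    simp only [frobSq, sq, hV1, hV2]
  have up := mul_hessForm_self_le (n := n) hη.le hlam hm0 hm1 hbal hstep V1 V2
  -- nonnegativity of the form at `D - η V` gives `η ‖V‖² ≤ ⟨D, V⟩`
  have nn := hessForm_self_nonneg (n := n) (m := m) hlam b1 b2 (D1 - η • V1) (D2 - η • V2)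
  rw [hessForm_sub_smul, ← q2] at nn
  rw [frobSq_sub_smul, frobSq_sub_smul]
  have u1 := mul_le_mul_of_nonneg_left up hη.le
  have u2 := mul_le_mul_of_nonneg_left nn hη.le
  have u3 := mul_le_mul_of_nonneg_left u1 hη.le
  have u4 := mul_le_mul_of_nonneg_left low hη.le
  rw [← q1] at *
  nlinarith

end Hessian

/-! ### The gradient step around the truth -/

section Step

variable {p K : ℕ}

/-- The weighted noise average `(1/n) ∑_i m_ik E_i`. -/
noncomputable def noiseAvg (n : ℕ) (m : ℕ → Fin K → ℝ) (E : ℕ → Matrix (Fin p) (Fin p) ℝ)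
    (k : Fin K) : Matrix (Fin p) (Fin p) ℝ :=
  (1 / (n : ℝ)) • ∑ i ∈ Finset.range n, m i k • E i

lemma noiseAvg_apply (n : ℕ) (m : ℕ → Fin K → ℝ) (E : ℕ → Matrix (Fin p) (Fin p) ℝ)
    (k : Fin K) (j l : Fin p) : noiseAvg n m E k j l = avg n fun i => m i k * E i j l := by
  simp [noiseAvg, avg, Matrix.sum_apply]

lemma noiseAvg_transpose (n : ℕ) (m : ℕ → Fin K → ℝ) (E : ℕ → Matrix (Fin p) (Fin p) ℝ)
    (k : Fin K) : noiseAvg n m (fun i => (E i).transpose) k = (noiseAvg n m E k).transpose := by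
  ext j l
  simp [noiseAvg_apply]

lemma avg_weight_mul_sum_noise (n : ℕ) (m : ℕ → Fin K → ℝ) (E : ℕ → Matrix (Fin p) (Fin p) ℝ)
    (k : Fin K) (j : Fin p) (c : Fin p → ℝ) :
    (avg n fun i => m i k * ∑ l, E i j l * c l) = ∑ l, noiseAvg n m E k j l * c l := by
  simp_rw [noiseAvg_apply, ← avg_mul_right, ← avg_sum, Finset.mul_sum, mul_assoc]

/-- The update of the first factor before truncation and thresholding. -/
noncomputable def gradStep (n : ℕ) (m : ℕ → Fin K → ℝ) (X : ℕ → Matrix (Fin p) (Fin p) ℝ)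
    (lam η : ℝ) (B1 B2 : Matrix (Fin p) (Fin K) ℝ) : Matrix (Fin p) (Fin K) ℝ :=
  B1 - η • matGrad (fun Z => loss n m X Z B2) B1 - η • matGrad (fun Z => balReg lam Z B2) B1

/-- The second update is the first one for the transposed data. -/
lemma IsStep.left_right {n : ℕ} {m : ℕ → Fin K → ℝ} {b1 b2 : Matrix (Fin p) (Fin K) ℝ}
    {E : ℕ → Matrix (Fin p) (Fin p) ℝ} {lam η : ℝ} {s : ℕ} {B1 B2 B1' B2' : Matrix (Fin p) (Fin K) ℝ}
    (h : IsStep n m (observe b1 b2 m E) lam η s B1 B2 B1' B2') :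
    IsHard s (posPart (gradStep n m (observe b1 b2 m E) lam η B1 B2)) B1' ∧
    IsHard s (posPart (gradStep n m (observe b2 b1 m fun i => (E i).transpose) lam η B2 B1)) B2' := by
  refine ⟨h.1, ?_⟩
  have e : (fun i => (observe b1 b2 m E i).transpose)
      = observe b2 b1 m fun i => (E i).transpose := by
    funext i
    simp [observe, Matrix.transpose_mul, Matrix.mul_assoc]
  have h2 := h.2
  simp_rw [loss_swap n m _ B1, balReg_swap lam B1, e] at h2
  exact h2

lemma abs_sum_le_card_mul {ι : Type*} [Fintype ι] {x : ι → ℝ} {c : ℝ} (h : ∀ i, |x i| ≤ c) :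
    |∑ i, x i| ≤ Fintype.card ι * c := by
  refine (Finset.abs_sum_le_sum_abs _ _).trans ((Finset.sum_le_sum fun i _ => h i).trans ?_)
  simp

variable {n : ℕ} {m : ℕ → Fin K → ℝ} {lam μ σ η : ℝ} {b1 b2 B1 B2 : Matrix (Fin p) (Fin K) ℝ}
  {E : ℕ → Matrix (Fin p) (Fin p) ℝ}

lemma observe_residual_apply (i : ℕ) (j l : Fin p) :
    (observe b1 b2 m E i - B1 * Matrix.diagonal (m i) * B2.transpose) j l
      = E i j l - (linPred m b1 b2 (B1 - b1) (B2 - b2) i j l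
        + ∑ k, m i k * ((B1 - b1) j k * (B2 - b2) l k)) := by
  have h : ∑ k, m i k * (B1 j k * B2 l k) = ∑ k, m i k * (b1 j k * b2 l k)
      + (linPred m b1 b2 (B1 - b1) (B2 - b2) i j l
        + ∑ k, m i k * ((B1 - b1) j k * (B2 - b2) l k)) := by
    rw [linPred, ← Finset.sum_add_distrib, ← Finset.sum_add_distrib]
    exact Finset.sum_congr rfl fun k _ => by simp only [Matrix.sub_apply]; ring
  rw [observe, Matrix.sub_apply, Matrix.add_apply, mul_diagonal_mul_transpose_apply,
    mul_diagonal_mul_transpose_apply, h]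
  ring

/-- Before thresholding, the error of the update is the linearized gradient step plus the noise
at the truth, up to a remainder that is small relative to the current error `d`. -/
lemma abs_gradStep_remainder_le {R d g : ℝ} (hη : 0 ≤ η) (hlam : 0 ≤ lam)
    (hm0 : ∀ i k, 0 ≤ m i k) (hm1 : ∀ i, ∑ k, m i k = 1)
    (hbal : ∀ k, ∑ j, b1 j k ^ 2 = ∑ j, b2 j k ^ 2) (hR : 1 ≤ R)
    (hR1 : ∀ j k, |b1 j k| ≤ R) (hR2 : ∀ j k, |b2 j k| ≤ R) (hd0 : 0 ≤ d) (hd1 : d ≤ 1)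
    (hD1 : ∀ j k, |(B1 - b1) j k| ≤ d) (hD2 : ∀ j k, |(B2 - b2) j k| ≤ d)
    (hg : ∀ k j l, |noiseAvg n m E k j l| ≤ g) (j : Fin p) (k : Fin K) :
    |gradStep n m (observe b1 b2 m E) lam η B1 B2 j k - b1 j k
        - (B1 - b1 - η • hessBlock n m lam b1 b2 (B1 - b1) (B2 - b2)) j k
        - η * ∑ l, noiseAvg n m E k j l * b2 l k|
      ≤ (η * p * R * (4 + 12 * lam) * d + η * p * g) * d := by
  set D1 := B1 - b1 with hD1def
  set D2 := B2 - b2 with hD2def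
  have e1 : ∀ j k, B1 j k = b1 j k + D1 j k := fun j k => by simp [hD1def]
  have e2 : ∀ j k, B2 j k = b2 j k + D2 j k := fun j k => by simp [hD2def]
  set P : ℕ → Fin p → Fin p → ℝ := fun i j l => ∑ k, m i k * (D1 j k * D2 l k) with hP
  have hgrad : matGrad (fun Z => loss n m (observe b1 b2 m E) Z B2) B1 j k
      = (avg n fun i => m i k * ∑ l, linPred m b1 b2 D1 D2 i j l * b2 l k)
        + (avg n fun i => m i k * ∑ l, (linPred m b1 b2 D1 D2 i j l * D2 l k + P i j l * B2 l k))
        - (∑ l, noiseAvg n m E k j l * b2 l k) - ∑ l, noiseAvg n m E k j l * D2 l k := by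
    rw [matGrad_loss_left, ← avg_weight_mul_sum_noise, ← avg_weight_mul_sum_noise, ← avg_add,
      ← avg_sub, ← avg_sub, ← neg_one_mul, ← avg_mul_left]
    congr 1
    funext i
    simp only [Finset.mul_sum]
    rw [← Finset.sum_add_distrib, ← Finset.sum_sub_distrib, ← Finset.sum_sub_distrib]
    refine Finset.sum_congr rfl fun l _ => ?_
    rw [observe_residual_apply, e2]
    ring
  have hh : (∑ a, B1 a k ^ 2) - ∑ a, B2 a k ^ 2
      = 2 * linBal b1 b2 D1 D2 k + ((∑ a, D1 a k ^ 2) - ∑ a, D2 a k ^ 2) := by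
    have : ∀ b D : Matrix (Fin p) (Fin K) ℝ, ∑ a, (b a k + D a k) ^ 2
        = ∑ a, b a k ^ 2 + 2 * ∑ a, b a k * D a k + ∑ a, D a k ^ 2 := by
      intro b D
      rw [Finset.mul_sum, ← Finset.sum_add_distrib, ← Finset.sum_add_distrib]
      exact Finset.sum_congr rfl fun a _ => by ring
    simp only [e1, e2, this, linBal, hbal k]
    ring
  have hlin : ∀ i j l, |linPred m b1 b2 D1 D2 i j l| ≤ 2 * R * d := fun i j l =>
    abs_sum_weight_mul_le (hm0 i) (hm1 i) fun k => by
      refine (abs_add_le _ _).trans ?_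
      rw [abs_mul, abs_mul]
      have t1 := mul_le_mul (hD1 j k) (hR2 l k) (abs_nonneg _) hd0
      have t2 := mul_le_mul (hR1 j k) (hD2 l k) (abs_nonneg _) (by linarith)
      linarith
  have hPb : ∀ i j l, |P i j l| ≤ d * d := fun i j l =>
    abs_sum_weight_mul_le (hm0 i) (hm1 i) fun k => by
      rw [abs_mul]
      exact mul_le_mul (hD1 j k) (hD2 l k) (abs_nonneg _) hd0
  have hB : ∀ (B b D : Matrix (Fin p) (Fin K) ℝ), (∀ j k, B j k = b j k + D j k) →
      (∀ j k, |b j k| ≤ R) → (∀ j k, |D j k| ≤ d) → ∀ j k, |B j k| ≤ 2 * R := by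
    intro B b D h hb hD j k
    rw [h]
    exact (abs_add_le _ _).trans (by linarith [hb j k, hD j k])
  have hdd : 0 ≤ d * d := mul_self_nonneg d
  -- the part of the loss gradient that is quadratic in the error
  have b1' : |avg n fun i => m i k *
      ∑ l, (linPred m b1 b2 D1 D2 i j l * D2 l k + P i j l * B2 l k)| ≤ p * (4 * R * (d * d)) := by
    refine abs_avg_le (by positivity) fun i => ?_
    rw [abs_mul, abs_of_nonneg (hm0 i k)]
    refine (mul_le_of_le_one_left (abs_nonneg _) (weight_le_one (hm0 i) (hm1 i) k)).trans ?_
    have := abs_sum_le_card_mul (c := 4 * R * (d * d))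
      (x := fun l => linPred m b1 b2 D1 D2 i j l * D2 l k + P i j l * B2 l k) fun l => by
        refine (abs_add_le _ _).trans ?_
        rw [abs_mul, abs_mul]
        have t1 := mul_le_mul (hlin i j l) (hD2 l k) (abs_nonneg _) (by positivity)
        have t2 := mul_le_mul (hPb i j l) (hB B2 b2 D2 e2 hR2 hD2 l k) (abs_nonneg _) hdd
        linarith
    simpa using this
  have b2' : |∑ l, noiseAvg n m E k j l * D2 l k| ≤ p * (g * d) := by
    have hg0 : 0 ≤ g := (abs_nonneg _).trans (hg k j j)
    have := abs_sum_le_card_mul (c := g * d) (x := fun l => noiseAvg n m E k j l * D2 l k)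
      fun l => by
        rw [abs_mul]
        exact mul_le_mul (hg k j l) (hD2 l k) (abs_nonneg _) hg0
    simpa using this
  have hz : |linBal b1 b2 D1 D2 k| ≤ 2 * (p * (R * d)) := by
    have side : ∀ b D : Matrix (Fin p) (Fin K) ℝ, (∀ j k, |b j k| ≤ R) → (∀ j k, |D j k| ≤ d) →
        |∑ a, b a k * D a k| ≤ p * (R * d) := by
      intro b D hb hD
      have := abs_sum_le_card_mul (c := R * d) (x := fun a => b a k * D a k) fun a => by
        rw [abs_mul]
        exact mul_le_mul (hb a k) (hD a k) (abs_nonneg _) (by linarith)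
      simpa using this
    have := (abs_sub _ _).trans (add_le_add (side b1 D1 hR1 hD1) (side b2 D2 hR2 hD2))
    rw [linBal]; linarith
  have hq : |(∑ a, D1 a k ^ 2) - ∑ a, D2 a k ^ 2| ≤ p * (d * d) := by
    have side : ∀ D : Matrix (Fin p) (Fin K) ℝ, (∀ j k, |D j k| ≤ d) →
        0 ≤ ∑ a, D a k ^ 2 ∧ ∑ a, D a k ^ 2 ≤ p * (d * d) := by
      intro D hD
      refine ⟨Finset.sum_nonneg fun _ _ => sq_nonneg _, ?_⟩
      have := abs_sum_le_card_mul (c := d * d) (x := fun a => D a k ^ 2) fun a => by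
        rw [abs_pow, sq]
        exact mul_le_mul (hD a k) (hD a k) (abs_nonneg _) hd0
      simpa using (le_abs_self _).trans this
    rw [abs_le]
    have s1 := side D1 hD1
    have s2 := side D2 hD2
    constructor <;> linarith
  have b3' : |2 * linBal b1 b2 D1 D2 k * D1 j k
      + ((∑ a, D1 a k ^ 2) - ∑ a, D2 a k ^ 2) * B1 j k| ≤ p * (6 * R * (d * d)) := by
    refine (abs_add_le _ _).trans ?_
    rw [abs_mul, abs_mul, abs_mul, abs_two]
    have t1 := mul_le_mul hz (hD1 j k) (abs_nonneg _) (by positivity)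
    have t2 := mul_le_mul hq (hB B1 b1 D1 e1 hR1 hD1 j k) (abs_nonneg _) (by positivity)
    linarith
  have main : gradStep n m (observe b1 b2 m E) lam η B1 B2 j k - b1 j k
        - (D1 - η • hessBlock n m lam b1 b2 D1 D2) j k - η * ∑ l, noiseAvg n m E k j l * b2 l k
      = -(η * (avg n fun i => m i k *
          ∑ l, (linPred m b1 b2 D1 D2 i j l * D2 l k + P i j l * B2 l k)))
        + η * (∑ l, noiseAvg n m E k j l * D2 l k)
        - η * (2 * lam) * (2 * linBal b1 b2 D1 D2 k * D1 j k
          + ((∑ a, D1 a k ^ 2) - ∑ a, D2 a k ^ 2) * B1 j k) := by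
    simp only [gradStep, Matrix.sub_apply, Matrix.smul_apply, smul_eq_mul, hgrad,
      matGrad_balReg_left, hh, hessBlock, Matrix.of_apply]
    rw [e1 j k]
    ring
  rw [main]
  refine (abs_sub _ _).trans ((add_le_add_left (abs_add_le _ _) _).trans ?_)
  rw [abs_neg, abs_mul, abs_mul, abs_mul, abs_of_nonneg hη, abs_of_nonneg (by positivity :
    0 ≤ η * (2 * lam))]
  have f1 := mul_le_mul_of_nonneg_left b1' hη
  have f2 := mul_le_mul_of_nonneg_left b2' hη
  have f3 := mul_le_mul_of_nonneg_left b3' (by positivity : 0 ≤ η * (2 * lam))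
  linarith

/-! ### Hard thresholding near the truth -/

/-- Thresholding is harmless near a nonnegative matrix `b` with at most `s` nonzero entries: the
kept entries include the support of `b`. -/
lemma IsHard.exists_frobSq_sub_le {s : ℕ} {U B' b : Matrix (Fin p) (Fin K) ℝ} {bm : ℝ}
    (h : IsHard s (posPart U) B') (hb : ∀ j k, 0 ≤ b j k) (hn : nnz b ≤ s)
    (hbm : ∀ j k, b j k ≠ 0 → bm ≤ b j k) (hU : ∀ j k, 2 * |U j k - b j k| < bm) :
    ∃ S : Finset (Fin p × Fin K), S.card ≤ s ∧
      frobSq (B' - b) ≤ ∑ q ∈ S, (U q.1 q.2 - b q.1 q.2) ^ 2 := by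
  obtain ⟨S, hcard, hS, hB'⟩ := h
  refine ⟨S, hcard ▸ min_le_left _ _, ?_⟩
  have hpos : ∀ j k, |posPart U j k - b j k| ≤ |U j k - b j k| := by
    intro j k
    have := abs_max_sub_max_le_abs (U j k) (b j k) 0
    rwa [max_eq_left (hb j k)] at this
  have hsupp : ∀ q, q ∉ S → b q.1 q.2 = 0 := by
    intro q hq
    by_contra hne
    classical
    set T : Finset (Fin p × Fin K) := Finset.univ.filter fun q => b q.1 q.2 ≠ 0 with hT
    have hTc : T.card ≤ s := by
      rw [nnz, Set.ncard_eq_toFinset_card'] at hn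
      simpa [hT] using hn
    have hTS : T.card ≤ S.card := by
      rw [hcard]
      refine le_min hTc ?_
      simpa using Finset.card_le_univ T
    have : ¬ S ⊆ T := fun hsub => hq (Finset.eq_of_subset_of_card_le hsub hTS ▸ by simp [hT, hne])
    obtain ⟨r, hrS, hrT⟩ := Finset.not_subset.1 this
    have hr0 : b r.1 r.2 = 0 := by simpa [hT] using hrT
    have h1 := hS r hrS q hq
    have h2 := (hpos q.1 q.2).trans_lt (by linarith [hU q.1 q.2] : _ < bm / 2)
    have h3 := (hpos r.1 r.2).trans_lt (by linarith [hU r.1 r.2] : _ < bm / 2)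
    rw [hr0, sub_zero] at h3
    have h4 := hbm q.1 q.2 hne
    rw [abs_lt] at h2
    linarith [le_abs_self (posPart U q.1 q.2)]
  have e : frobSq (B' - b) = ∑ q ∈ S, (posPart U q.1 q.2 - b q.1 q.2) ^ 2 := by
    rw [frobSq, ← Fintype.sum_prod_type', ← Finset.sum_subset (Finset.subset_univ S)]
    · exact Finset.sum_congr rfl fun q hq => by rw [Matrix.sub_apply, hB', if_pos hq]
    · intro q _ hq
      rw [Matrix.sub_apply, hB', if_neg hq, hsupp q hq]; simp
  rw [e]
  exact Finset.sum_le_sum fun q _ => sq_le_sq.2 (hpos q.1 q.2)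

/-! ### The statistical error -/

lemma innerMat_eq_sum {a b : ℕ} (A B : Matrix (Fin a) (Fin b) ℝ) :
    innerMat A B = ∑ q : Fin a × Fin b, A q.1 q.2 * B q.1 q.2 := by
  rw [innerMat, Fintype.sum_prod_type, Finset.sum_comm]
  simp [Matrix.trace, Matrix.mul_apply]

lemma sum_innerMat_le (G D : Fin K → Matrix (Fin p) (Fin p) ℝ) :
    (∑ k, innerMat (G k) (D k)) ^ 2 ≤ (∑ k, frobSq (G k)) * ∑ k, frobSq (D k) := by
  simp only [innerMat_eq_sum, frobSq, ← Fintype.sum_prod_type']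
  exact Finset.sum_mul_sq_le_sq_mul_sq _ _ _

lemma abs_sum_innerMat_noiseAvg_le {s : ℕ} {D : Fin K → Matrix (Fin p) (Fin p) ℝ}
    (hD : D ∈ statDirections p K s) :
    |∑ k, innerMat (noiseAvg n m E k) (D k)| ≤ √(∑ k, frobSq (noiseAvg n m E k)) := by
  refine Real.abs_le_sqrt ?_
  have := sum_innerMat_le (fun k => noiseAvg n m E k) D
  rwa [hD.2.2, mul_one] at this

lemma le_statError {s : ℕ} {D : Fin K → Matrix (Fin p) (Fin p) ℝ}
    (hD : D ∈ statDirections p K s) :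
    ∑ k, innerMat (noiseAvg n m E k) (D k) ≤ statError s n m E := by
  refine le_csSup ⟨√(∑ k, frobSq (noiseAvg n m E k)), ?_⟩ ⟨D, hD, rfl⟩
  rintro _ ⟨D, hD, rfl⟩
  exact (abs_le.1 (abs_sum_innerMat_noiseAvg_le hD)).2

lemma sq_statError_le (s : ℕ) : statError s n m E ^ 2 ≤ ∑ k, frobSq (noiseAvg n m E k) := by
  have h0 : 0 ≤ ∑ k, frobSq (noiseAvg n m E k) := Finset.sum_nonneg fun k _ =>
    Finset.sum_nonneg fun _ _ => Finset.sum_nonneg fun _ _ => sq_nonneg _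
  rw [← Real.sq_sqrt h0]
  refine sq_le_sq' ?_ ?_
  · rcases (statDirections p K s).eq_empty_or_nonempty with h | ⟨D, hD⟩
    · -- the supremum over no directions is zero
      simp [statError, h]
    · exact (abs_le.1 (abs_sum_innerMat_noiseAvg_le hD)).1.trans (le_statError hD)
  · refine Real.sSup_le ?_ (Real.sqrt_nonneg _)
    rintro _ ⟨D, hD, rfl⟩
    exact (abs_le.1 (abs_sum_innerMat_noiseAvg_le hD)).2

lemma abs_noiseAvg_le_statError {s : ℕ} (hs : 1 ≤ s) (k : Fin K) (j l : Fin p) :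
    |noiseAvg n m E k j l| ≤ statError s n m E := by
  have key : ∀ ε : ℝ, ε ^ 2 = 1 → ε * noiseAvg n m E k j l ≤ statError s n m E := by
    intro ε hε
    set D : Fin K → Matrix (Fin p) (Fin p) ℝ :=
      fun k' => if k' = k then Matrix.single j l ε else 0 with hD
    have hmem : D ∈ statDirections p K s := by
      refine ⟨fun k' => ?_, fun k' => ?_, ?_⟩
      · rw [hD]
        dsimp only
        split_ifs
        · rw [show Matrix.single j l ε
              = Matrix.vecMulVec (Pi.single j ε) (Pi.single l (1 : ℝ)) by
            ext a b
            by_cases h1 : j = a <;> by_cases h2 : l = b <;>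
              simp [Matrix.vecMulVec_apply, h1, h2, Ne.symm]]
          exact (Matrix.rank_vecMulVec_le _ _).trans one_le_two
        · simp
      · rw [nnz]
        refine le_trans ?_ hs
        rw [← Set.ncard_singleton (j, l)]
        refine Set.ncard_le_ncard ?_ (Set.finite_singleton _)
        rintro ⟨a, b⟩ hab
        by_contra hne
        refine hab ?_
        rw [hD]
        dsimp only
        split_ifs
        · rw [Matrix.single_apply, if_neg]
          rintro ⟨rfl, rfl⟩
          exact hne rfl
        · rfl
      · rw [Fintype.sum_eq_single k, frobSq, Fintype.sum_eq_single j, Fintype.sum_eq_single l]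
        · simpa [hD] using hε
        · intro b hb; simp [hD, hb.symm]
        · intro a ha; simp [hD, ha.symm]
        · intro k' hk'; simp [hD, hk', frobSq]
    have hval : ∑ k', innerMat (noiseAvg n m E k') (D k') = ε * noiseAvg n m E k j l := by
      rw [Fintype.sum_eq_single k, innerMat_eq_sum, Fintype.sum_eq_single (j, l)]
      · simp [hD, mul_comm]
      · rintro ⟨a, b⟩ hab
        have : ¬ (j = a ∧ l = b) := fun h => hab (by rw [h.1, h.2])
        simp [hD, this]
      · intro k' hk'; simp [hD, hk', innerMat]
    rw [← hval]
    exact le_statError hmem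
  rw [abs_le]
  constructor
  · linarith [key (-1) (by norm_num)]
  · linarith [key 1 (by norm_num)]

end Step

/-! ### One iteration -/

section OneStep

variable {p K n s : ℕ} {m : ℕ → Fin K → ℝ} {lam μ σ η : ℝ}
  {b1 b2 B1 B2 B1' B2' : Matrix (Fin p) (Fin K) ℝ} {E : ℕ → Matrix (Fin p) (Fin p) ℝ}

lemma sq_le_frobSq {a b : ℕ} (A : Matrix (Fin a) (Fin b) ℝ) (j : Fin a) (k : Fin b) :
    A j k ^ 2 ≤ frobSq A :=
  (Finset.single_le_sum (f := fun k => A j k ^ 2) (fun _ _ => sq_nonneg _)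
    (Finset.mem_univ k)).trans (Finset.single_le_sum (f := fun j => ∑ k, A j k ^ 2)
      (fun _ _ => Finset.sum_nonneg fun _ _ => sq_nonneg _) (Finset.mem_univ j))

lemma sq_add_le {θ : ℝ} (hθ : 0 < θ) (x y : ℝ) :
    (x + y) ^ 2 ≤ (1 + θ) * x ^ 2 + (1 + θ⁻¹) * y ^ 2 := by
  have h : 0 ≤ θ⁻¹ * (θ * x - y) ^ 2 := by positivity
  have e : θ⁻¹ * (θ * x - y) ^ 2 = θ * x ^ 2 - 2 * (x * y) + θ⁻¹ * y ^ 2 := by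
    field_simp; ring
  linarith

/-- The thresholded update of one factor: `A` is the linearized step, `c` the noise at the truth,
and `ρ` bounds the remainder. The noise is counted only on the at most `s` kept entries. -/
lemma IsHard.frobSq_sub_le {U A c : Matrix (Fin p) (Fin K) ℝ} {bm τ c0 ρ κ θ : ℝ} (hθ : 0 < θ)
    (h : IsHard s (posPart U) B1') (hb : ∀ j k, 0 ≤ b1 j k) (hn : nnz b1 ≤ s)
    (hbm : ∀ j k, b1 j k ≠ 0 → bm ≤ b1 j k)
    (hdec : ∀ j k, |U j k - b1 j k - A j k - c j k| ≤ ρ) (hA : ∀ j k, |A j k| ≤ τ)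
    (hc : ∀ j k, |c j k| ≤ c0) (hsmall : 2 * (τ + c0 + ρ) < bm) (hκ : ∀ j k, c j k ^ 2 ≤ κ)
    (hκ0 : 0 ≤ κ) :
    frobSq (B1' - b1)
      ≤ (1 + θ) * frobSq A + (1 + θ⁻¹) * (2 * (s * κ) + 2 * (p * K * ρ ^ 2)) := by
  have hU : ∀ j k, |U j k - b1 j k| ≤ τ + c0 + ρ := by
    intro j k
    have e : U j k - b1 j k = A j k + c j k + (U j k - b1 j k - A j k - c j k) := by ring
    rw [e]
    exact (abs_add_le _ _).trans (add_le_add ((abs_add_le _ _).trans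
      (add_le_add (hA j k) (hc j k))) (hdec j k))
  obtain ⟨S, hS, hle⟩ := h.exists_frobSq_sub_le hb hn hbm fun j k => by linarith [hU j k]
  refine hle.trans ?_
  have hpt : ∀ q : Fin p × Fin K, (U q.1 q.2 - b1 q.1 q.2) ^ 2
      ≤ (1 + θ) * A q.1 q.2 ^ 2 + (1 + θ⁻¹) * (2 * κ + 2 * ρ ^ 2) := by
    intro q
    have e : U q.1 q.2 - b1 q.1 q.2 = A q.1 q.2
      + (c q.1 q.2 + (U q.1 q.2 - b1 q.1 q.2 - A q.1 q.2 - c q.1 q.2)) := by ring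
    rw [e]
    refine (sq_add_le hθ _ _).trans ?_
    gcongr
    have h1 := hκ q.1 q.2
    have h2 : (U q.1 q.2 - b1 q.1 q.2 - A q.1 q.2 - c q.1 q.2) ^ 2 ≤ ρ ^ 2 := by
      rw [← sq_abs]
      exact pow_le_pow_left₀ (abs_nonneg _) (hdec _ _) 2
    refine add_sq_le.trans ?_
    linarith
  have hcard : (S.card : ℝ) ≤ s := by exact_mod_cast hS
  have hcard' : (S.card : ℝ) ≤ p * K := by
    have := Finset.card_le_univ S
    simp only [Fintype.card_prod, Fintype.card_fin] at this
    exact_mod_cast this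
  calc _ ≤ ∑ q ∈ S, ((1 + θ) * A q.1 q.2 ^ 2 + (1 + θ⁻¹) * (2 * κ + 2 * ρ ^ 2)) :=
        Finset.sum_le_sum fun q _ => hpt q
    _ = (1 + θ) * ∑ q ∈ S, A q.1 q.2 ^ 2
          + (1 + θ⁻¹) * (2 * (S.card * κ) + 2 * (S.card * ρ ^ 2)) := by
        rw [Finset.sum_add_distrib, ← Finset.mul_sum, Finset.sum_const, nsmul_eq_mul]; ring
    _ ≤ _ := by
        gcongr
        rw [frobSq, ← Fintype.sum_prod_type']
        exact Finset.sum_le_sum_of_subset_of_nonneg (Finset.subset_univ _)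
          fun _ _ _ => sq_nonneg _

/-- A noise entry tested against a sparse column is controlled by the statistical error, with a
constant depending only on the sparsity. -/
lemma sq_mul_sum_noise_le {G : Matrix (Fin p) (Fin p) ℝ} {b : Matrix (Fin p) (Fin K) ℝ} {e : ℝ}
    (hη : 0 ≤ η) (hG : ∀ j l, |G j l| ≤ e) (hn : nnz b ≤ s) (k : Fin K)
    (hb : η * ∑ l, b l k ^ 2 ≤ 1) (j : Fin p) :
    (η * ∑ l, G j l * b l k) ^ 2 ≤ s * η * e ^ 2 := by
  classical
  set T : Finset (Fin p) := Finset.univ.filter fun l => b l k ≠ 0 with hT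
  have hTc : (T.card : ℝ) ≤ s := by
    have h1 : T.card ≤ nnz b := by
      rw [nnz, ← Set.ncard_coe_finset]
      refine Set.ncard_le_ncard_of_injOn (fun l => (l, k)) ?_ ?_ (Set.toFinite _)
      · intro l hl; simpa [hT] using hl
      · intro l _ l' _ h; exact (Prod.ext_iff.1 h).1
    exact_mod_cast h1.trans hn
  have e1 : ∑ l, G j l * b l k = ∑ l ∈ T, G j l * b l k := by
    refine (Finset.sum_subset (Finset.subset_univ T) fun l _ hl => ?_).symm
    have : b l k = 0 := by simpa [hT] using hl
    rw [this, mul_zero]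
  have e2 : ∑ l ∈ T, G j l ^ 2 ≤ s * e ^ 2 := by
    calc _ ≤ ∑ l ∈ T, e ^ 2 := Finset.sum_le_sum fun l _ => by
          rw [← sq_abs]; exact pow_le_pow_left₀ (abs_nonneg _) (hG j l) 2
      _ = T.card * e ^ 2 := by simp
      _ ≤ _ := by gcongr
  have e3 : ∑ l ∈ T, b l k ^ 2 ≤ ∑ l, b l k ^ 2 :=
    Finset.sum_le_sum_of_subset_of_nonneg (Finset.subset_univ _) fun _ _ _ => sq_nonneg _
  rw [mul_pow, e1]
  calc _ ≤ η ^ 2 * ((∑ l ∈ T, G j l ^ 2) * ∑ l ∈ T, b l k ^ 2) := by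
        gcongr; exact Finset.sum_mul_sq_le_sq_mul_sq _ _ _
    _ ≤ η ^ 2 * ((s * e ^ 2) * ∑ l, b l k ^ 2) := by gcongr
    _ = s * η * e ^ 2 * (η * ∑ l, b l k ^ 2) := by ring
    _ ≤ s * η * e ^ 2 * 1 := by gcongr
    _ = _ := mul_one _

/-- One iteration started in a small neighbourhood of the truth contracts the squared distance, up
to the statistical error. -/
lemma IsStep.dSq_le {R bm τ c0 γ g q : ℝ} (hη : 0 < η) (hμ : 0 < μ) (hlam : 0 < lam)
    (hT : TopicCondition μ n m) (hm0 : ∀ i k, 0 ≤ m i k) (hm1 : ∀ i, ∑ k, m i k = 1)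
    (hb1 : ∀ j k, 0 ≤ b1 j k) (hb2 : ∀ j k, 0 ≤ b2 j k)
    (hbal : ∀ k, ∑ j, b1 j k ^ 2 = ∑ j, b2 j k ^ 2) (hσ : ∀ k, σ ≤ ∑ j, b1 j k ^ 2)
    (hstep : ∀ k, η * (2 + 8 * lam) * ∑ j, b1 j k ^ 2 ≤ 1)
    (hs : 1 ≤ s) (hn1 : nnz b1 ≤ s) (hn2 : nnz b2 ≤ s) (hR : 1 ≤ R)
    (hR1 : ∀ j k, |b1 j k| ≤ R) (hR2 : ∀ j k, |b2 j k| ≤ R)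
    (hbm1 : ∀ j k, b1 j k ≠ 0 → bm ≤ b1 j k) (hbm2 : ∀ j k, b2 j k ≠ 0 → bm ≤ b2 j k)
    (hg : ∀ k j l, |noiseAvg n m E k j l| ≤ g)
    (hτ0 : 0 ≤ τ) (hτ1 : τ ≤ 1) (hq0 : 0 < q)
    (hq : q ≤ η * (min μ (4 * lam) * σ)) (hc0 : p * (η * (g * R)) ≤ c0)
    (hγ0 : 0 ≤ γ) (hγ : η * p * R * (4 + 12 * lam) * τ + η * p * g ≤ γ)
    (hsmall : 2 * (τ + c0 + γ * τ) < bm)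
    (hγq : (1 + (q / 2)⁻¹) * (4 * (p * K * γ ^ 2)) ≤ q / 4)
    (hd : dSq B1 B2 b1 b2 ≤ τ ^ 2)
    (h : IsStep n m (observe b1 b2 m E) lam η s B1 B2 B1' B2') :
    dSq B1' B2' b1 b2 ≤ (1 - q / 4) * dSq B1 B2 b1 b2
      + (1 + (q / 2)⁻¹) * (4 * (s ^ 2 * η)) * statError s n m E ^ 2 := by
  obtain ⟨hl, hr⟩ := h.left_right
  have hF1 := frobSq_nonneg (B1 - b1)
  have hF2 := frobSq_nonneg (B2 - b2)
  have hd0 : 0 ≤ dSq B1 B2 b1 b2 := add_nonneg hF1 hF2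
  set d := √(dSq B1 B2 b1 b2) with hdd
  have hdnn : 0 ≤ d := Real.sqrt_nonneg _
  have hdsq : d ^ 2 = dSq B1 B2 b1 b2 := Real.sq_sqrt hd0
  have hdτ : d ≤ τ := Real.sqrt_le_iff.2 ⟨hτ0, hd⟩
  have hD1 : ∀ j k, |(B1 - b1) j k| ≤ d := fun j k =>
    abs_le_of_sq_le_sq (by rw [hdsq]; exact (sq_le_frobSq _ j k).trans (by unfold dSq; linarith))
      hdnn
  have hD2 : ∀ j k, |(B2 - b2) j k| ≤ d := fun j k =>
    abs_le_of_sq_le_sq (by rw [hdsq]; exact (sq_le_frobSq _ j k).trans (by unfold dSq; linarith))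
      hdnn
  have hg' : ∀ k j l, |noiseAvg n m (fun i => (E i).transpose) k j l| ≤ g := fun k j l => by
    rw [noiseAvg_transpose]; exact hg k l j
  have lin := frobSq_linear_step_le (n := n) hη hμ.le hlam.le hT hm0 hm1 hbal hσ hstep
    (B1 - b1) (B2 - b2)
  set A1 := B1 - b1 - η • hessBlock n m lam b1 b2 (B1 - b1) (B2 - b2) with hA1
  set A2 := B2 - b2 - η • hessBlock n m lam b2 b1 (B2 - b2) (B1 - b1) with hA2
  have hlin : frobSq A1 + frobSq A2 ≤ (1 - q) * d ^ 2 := by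
    rw [hdsq]
    exact lin.trans (mul_le_mul_of_nonneg_right (by linarith) hd0)
  have hlin' : frobSq A1 + frobSq A2 ≤ τ ^ 2 :=
    hlin.trans ((mul_le_of_le_one_left (sq_nonneg _) (by linarith)).trans
      (pow_le_pow_left₀ hdnn hdτ 2))
  have nA1 := frobSq_nonneg A1
  have nA2 := frobSq_nonneg A2
  have hA1e : ∀ j k, |A1 j k| ≤ τ := fun j k =>
    abs_le_of_sq_le_sq ((sq_le_frobSq _ j k).trans (by linarith)) hτ0
  have hA2e : ∀ j k, |A2 j k| ≤ τ := fun j k =>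
    abs_le_of_sq_le_sq ((sq_le_frobSq _ j k).trans (by linarith)) hτ0
  have hγd : (η * p * R * (4 + 12 * lam) * d + η * p * g) * d ≤ γ * d := by
    refine mul_le_mul_of_nonneg_right (le_trans ?_ hγ) hdnn
    gcongr
  have hr1 := fun j k => (abs_gradStep_remainder_le hη.le hlam.le hm0 hm1 hbal hR hR1 hR2 hdnn
    (hdτ.trans hτ1) hD1 hD2 hg j k).trans hγd
  have hr2 := fun j k => (abs_gradStep_remainder_le hη.le hlam.le hm0 hm1 (fun k => (hbal k).symm)
    hR hR2 hR1 hdnn (hdτ.trans hτ1) hD2 hD1 hg' j k).trans hγd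
  have hcb : ∀ (G : Fin K → Matrix (Fin p) (Fin p) ℝ) (b : Matrix (Fin p) (Fin K) ℝ),
      (∀ k j l, |G k j l| ≤ g) → (∀ j k, |b j k| ≤ R) →
      ∀ j k, |η * ∑ l, G k j l * b l k| ≤ c0 := by
    intro G b hG hb j k
    have hg0 : 0 ≤ g := (abs_nonneg _).trans (hG k j j)
    have := abs_sum_le_card_mul (c := g * R) (x := fun l => G k j l * b l k) fun l => by
      rw [abs_mul]
      exact mul_le_mul (hG k j l) (hb l k) (abs_nonneg _) hg0
    rw [Fintype.card_fin] at this
    rw [abs_mul, abs_of_pos hη]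
    linarith [mul_le_mul_of_nonneg_left this hη.le]
  have hηb : ∀ k, η * ∑ j, b1 j k ^ 2 ≤ 1 := fun k => by
    have : 0 ≤ η * ∑ j, b1 j k ^ 2 := mul_nonneg hη.le (Finset.sum_nonneg fun _ _ => sq_nonneg _)
    linarith [hstep k, mul_nonneg hlam.le this]
  have he : ∀ k j l, |noiseAvg n m E k j l| ≤ statError s n m E :=
    abs_noiseAvg_le_statError hs
  have hκ1 : ∀ j k, (η * ∑ l, noiseAvg n m E k j l * b2 l k) ^ 2
      ≤ s * η * statError s n m E ^ 2 := fun j k =>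
    sq_mul_sum_noise_le hη.le (he k) hn2 k (hbal k ▸ hηb k) j
  have hκ2 : ∀ j k, (η * ∑ l, noiseAvg n m (fun i => (E i).transpose) k j l * b1 l k) ^ 2
      ≤ s * η * statError s n m E ^ 2 := fun j k =>
    sq_mul_sum_noise_le hη.le (fun j l => by rw [noiseAvg_transpose]; exact he k l j) hn1 k
      (hηb k) j
  have hsm : 2 * (τ + c0 + γ * d) < bm := by
    linarith [mul_le_mul_of_nonneg_left hdτ hγ0]
  have half1 := hl.frobSq_sub_le (A := A1)
    (c := Matrix.of fun j k => η * ∑ l, noiseAvg n m E k j l * b2 l k) (θ := q / 2) (by positivity)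
    hb1 hn1 hbm1 hr1 hA1e (hcb _ b2 hg hR2) hsm hκ1 (by positivity)
  have half2 := hr.frobSq_sub_le (A := A2)
    (c := Matrix.of fun j k =>
      η * ∑ l, noiseAvg n m (fun i => (E i).transpose) k j l * b1 l k)
    (θ := q / 2) (by positivity)
    hb2 hn2 hbm2 hr2 hA2e (hcb _ b1 hg' hR1) hsm hκ2 (by positivity)
  rw [← hdsq]
  have t1 : (1 + q / 2) * (frobSq A1 + frobSq A2) ≤ (1 - q / 2) * d ^ 2 := by
    calc _ ≤ (1 + q / 2) * ((1 - q) * d ^ 2) := by gcongr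
      _ = (1 - q / 2) * d ^ 2 - q ^ 2 / 2 * d ^ 2 := by ring
      _ ≤ _ := by linarith [mul_nonneg (sq_nonneg q) (sq_nonneg d)]
  have t2 := mul_le_mul_of_nonneg_right hγq (sq_nonneg d)
  calc dSq B1' B2' b1 b2 = frobSq (B1' - b1) + frobSq (B2' - b2) := rfl
    _ ≤ _ := add_le_add half1 half2
    _ = (1 + q / 2) * (frobSq A1 + frobSq A2)
        + (1 + (q / 2)⁻¹) * (4 * (p * K * γ ^ 2)) * d ^ 2
        + (1 + (q / 2)⁻¹) * (4 * (s ^ 2 * η)) * statError s n m E ^ 2 := by ring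
    _ ≤ _ := by linarith

end OneStep

/-! ### Initialization -/

section Init

variable {p K n : ℕ} {m : ℕ → Fin K → ℝ} {μ σ : ℝ}
  {b1 b2 B1 B2 : Matrix (Fin p) (Fin K) ℝ} {E : ℕ → Matrix (Fin p) (Fin p) ℝ}

lemma relaxedLoss_eq (Th : Fin K → Matrix (Fin p) (Fin p) ℝ) :
    relaxedLoss n m (observe b1 b2 m E) Th
      = 1 / 2 * avg n fun i => ∑ j, ∑ l,
          (E i j l - ∑ k, m i k * (Th k - theta b1 b2 k) j l) ^ 2 := by
  have h : ∀ i j l, (observe b1 b2 m E i - ∑ k, m i k • Th k) j l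
      = E i j l - ∑ k, m i k * (Th k - theta b1 b2 k) j l := by
    intro i j l
    have e : ∑ k, m i k * (Th k - theta b1 b2 k) j l
        = ∑ k, m i k * Th k j l - ∑ k, m i k * (b1 j k * b2 l k) := by
      rw [← Finset.sum_sub_distrib]
      exact Finset.sum_congr rfl fun k _ => by
        rw [Matrix.sub_apply, theta, Matrix.vecMulVec_apply, mul_sub]; rfl
    rw [e, observe, Matrix.sub_apply, Matrix.add_apply, mul_diagonal_mul_transpose_apply,
      Matrix.sum_apply]
    simp only [Matrix.smul_apply, smul_eq_mul]
    ring
  simp only [relaxedLoss, frobSq, h, avg, ← mul_assoc]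
  congr 1
  rw [one_div_mul_one_div]

/-- The relaxed estimator is consistent: its error is controlled by the averaged noise. -/
lemma sum_frobSq_relaxed_sub_le (hμ : 0 < μ) (hT : TopicCondition μ n m)
    {Th : Fin K → Matrix (Fin p) (Fin p) ℝ}
    (hmin : ∀ Th', relaxedLoss n m (observe b1 b2 m E) Th
      ≤ relaxedLoss n m (observe b1 b2 m E) Th') :
    μ ^ 2 * ∑ k, frobSq (Th k - theta b1 b2 k) ≤ 4 * ∑ k, frobSq (noiseAvg n m E k) := by
  have h0 := hmin (theta b1 b2)
  rw [relaxedLoss_eq, relaxedLoss_eq] at h0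
  set D : Fin K → Matrix (Fin p) (Fin p) ℝ := fun k => Th k - theta b1 b2 k with hD
  change μ ^ 2 * ∑ k, frobSq (D k) ≤ _
  have h1 : (avg n fun i => ∑ j, ∑ l, (∑ k, m i k * D k j l) ^ 2)
      ≤ 2 * ∑ k, innerMat (noiseAvg n m E k) (D k) := by
    have e1 : ∀ i j l, (E i j l - ∑ k, m i k * (Th k - theta b1 b2 k) j l) ^ 2
        = E i j l ^ 2 - 2 * (E i j l * ∑ k, m i k * D k j l) + (∑ k, m i k * D k j l) ^ 2 :=
      fun i j l => by ring
    have e2 : (avg n fun i => ∑ j, ∑ l, E i j l * ∑ k, m i k * D k j l)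
        = ∑ k, innerMat (noiseAvg n m E k) (D k) := by
      simp only [innerMat_eq_sum, Fintype.sum_prod_type, noiseAvg_apply, ← avg_mul_right,
        ← avg_sum]
      congr 1
      funext i
      rw [← sum_entries_comm]
      refine Finset.sum_congr rfl fun j _ => Finset.sum_congr rfl fun l _ => ?_
      rw [Finset.mul_sum]
      exact Finset.sum_congr rfl fun k _ => by ring
    simp only [e1, sub_self, Matrix.zero_apply, mul_zero, Finset.sum_const_zero, sub_zero,
      Finset.sum_add_distrib, Finset.sum_sub_distrib, ← Finset.mul_sum, avg_add, avg_sub,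
      avg_mul_left, e2] at h0
    linarith
  have h2 : μ * ∑ k, frobSq (D k) ≤ avg n fun i => ∑ j, ∑ l, (∑ k, m i k * D k j l) ^ 2 := by
    unfold frobSq
    rw [← sum_entries_comm, avg_sum, Finset.mul_sum]
    refine Finset.sum_le_sum fun j _ => ?_
    rw [avg_sum, Finset.mul_sum]
    exact Finset.sum_le_sum fun l _ => hT.le_avg _
  have h3 := sum_innerMat_le (fun k => noiseAvg n m E k) D
  have hx : 0 ≤ ∑ k, frobSq (D k) := Finset.sum_nonneg fun k _ => frobSq_nonneg _
  have hG : 0 ≤ ∑ k, frobSq (noiseAvg n m E k) := Finset.sum_nonneg fun k _ => frobSq_nonneg _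
  generalize (∑ k, frobSq (D k)) = x at *
  generalize (∑ k, frobSq (noiseAvg n m E k)) = G at *
  generalize (∑ k, innerMat (noiseAvg n m E k) (D k)) = S at *
  rcases hx.eq_or_lt with rfl | hx
  · simpa using hG
  · have h4 : (μ * x) ^ 2 ≤ (2 * S) ^ 2 := pow_le_pow_left₀ (by positivity) (h2.trans h1) 2
    refine le_of_mul_le_mul_right ?_ hx
    linarith

lemma IsInit.dSq_le {ε : ℝ} (hμ : 0 < μ) (hσ0 : 0 < σ) (hT : TopicCondition μ n m)
    (hb1 : ∀ j k, 0 ≤ b1 j k) (hb2 : ∀ j k, 0 ≤ b2 j k)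
    (hbal : ∀ k, ∑ j, b1 j k ^ 2 = ∑ j, b2 j k ^ 2) (hσ : ∀ k, σ ≤ ∑ j, b1 j k ^ 2)
    (hε : 0 ≤ ε) (hG : ∑ k, frobSq (noiseAvg n m E k) ≤ ε ^ 2)
    (he1 : 4 * (2 * ε / μ) ≤ σ) (he2 : 4 * (p * (2 * ε / μ)) < σ)
    (h : IsInit n m (observe b1 b2 m E) B1 B2) : dSq B1 B2 b1 b2 ≤ K * (14 * (2 * ε / μ)) := by
  obtain ⟨Th, u, v, sv, hmin, hsvd, hsign, hB1, hB2⟩ := h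
  have hTh := sum_frobSq_relaxed_sub_le hμ hT hmin
  have hk : ∀ k, frobSq (Th k - theta b1 b2 k) ≤ (2 * ε / μ) ^ 2 := by
    intro k
    have h1 : frobSq (Th k - theta b1 b2 k) ≤ ∑ k, frobSq (Th k - theta b1 b2 k) :=
      Finset.single_le_sum (f := fun k => frobSq (Th k - theta b1 b2 k))
        (fun _ _ => frobSq_nonneg _) (Finset.mem_univ k)
    rw [div_pow, le_div_iff₀ (by positivity)]
    linarith [mul_le_mul_of_nonneg_right h1 (sq_nonneg μ)]
  have hcol : ∀ k, ∑ j, (B1 - b1) j k ^ 2 ≤ 7 * (2 * ε / μ) ∧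
      ∑ j, (B2 - b2) j k ^ 2 ≤ 7 * (2 * ε / μ) := by
    intro k
    have hpos : 0 < ∑ j, b1 j k ^ 2 := hσ0.trans_le (hσ k)
    have hsq : √(∑ j, b1 j k ^ 2) ^ 2 = ∑ j, b1 j k ^ 2 := Real.sq_sqrt hpos.le
    have := (hsvd k).close (b1 := b1.col k) (b2 := b2.col k) (r := √(∑ j, b1 j k ^ 2))
      (e := 2 * ε / μ) (Real.sqrt_pos.2 hpos) (by positivity) (fun j => hb1 j k)
      (fun j => hb2 j k) hsq.symm (by rw [hsq, hbal]; rfl) (hsign k) (hk k)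
      (by rw [hsq]; exact he1.trans (hσ k)) (by rw [hsq]; exact he2.trans_le (hσ k))
    simp only [Matrix.sub_apply, hB1, hB2]
    exact this
  rw [dSq, frobSq_eq_sum_col, frobSq_eq_sum_col, ← Finset.sum_add_distrib]
  calc _ ≤ ∑ k : Fin K, 14 * (2 * ε / μ) := Finset.sum_le_sum fun k _ => by
        linarith [(hcol k).1, (hcol k).2]
    _ = _ := by simp

end Init

/-! ### Runs under small noise -/

section Deterministic

variable {p K : ℕ}

/-- The step-size rule, evaluated at an initial value close to the truth, bounds the step size in
terms of the truth. -/
lemma step_size_bound {μ lam η σ : ℝ} {b1 B1 B2 : Matrix (Fin p) (Fin K) ℝ} 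
    (hlam : 0 < lam) (hη : 0 < η)
    (hstep : η ≤ 1 / (16 * specNorm (Matrix.fromCols B1 B2) ^ 2) *
      min (1 / (2 * (μ + 1))) (min 1 (1 / lam)))
    (k : Fin K) (hσ : σ ≤ ∑ j, b1 j k ^ 2) (hD : 24 * frobSq (B1 - b1) ≤ σ) :
    η * (2 + 8 * lam) * ∑ j, b1 j k ^ 2 ≤ 1 := by
  have hB := sum_sq_col_le_specNorm_fromCols B1 B2 k
  have hS0 := specNorm_nonneg (Matrix.fromCols B1 B2)
  generalize specNorm (Matrix.fromCols B1 B2) = S at *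
  -- at `S = 0` the junk value of the quotient makes the bound on `η` zero
  have hS : 0 < S := by
    rcases hS0.eq_or_lt with rfl | h
    · norm_num at hstep; linarith
    · exact h
  have h1 : η * (16 * S ^ 2) ≤ min (1 / (2 * (μ + 1))) (min 1 (1 / lam)) := by
    rw [one_div_mul_eq_div, le_div_iff₀ (by positivity)] at hstep
    exact hstep
  have h2 : η * (16 * S ^ 2) ≤ 1 := h1.trans ((min_le_right _ _).trans (min_le_left _ _))
  have h3 : η * (16 * S ^ 2) * lam ≤ 1 := by
    rw [← le_div_iff₀ hlam]
    exact h1.trans ((min_le_right _ _).trans (min_le_right _ _))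
  have h4 : ∑ j, b1 j k ^ 2 ≤ 8 / 5 * S ^ 2 := by
    have hcol : ∑ j, (B1 - b1) j k ^ 2 ≤ frobSq (B1 - b1) := by
      rw [frobSq_eq_sum_col]
      exact Finset.single_le_sum (f := fun k => ∑ j, (B1 - b1) j k ^ 2)
        (fun _ _ => Finset.sum_nonneg fun _ _ => sq_nonneg _) (Finset.mem_univ k)
    have hpt : ∑ j, b1 j k ^ 2 ≤ 6 / 5 * ∑ j, B1 j k ^ 2 + 6 * ∑ j, (B1 - b1) j k ^ 2 := by
      rw [Finset.mul_sum, Finset.mul_sum, ← Finset.sum_add_distrib]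
      refine Finset.sum_le_sum fun j _ => ?_
      have := sq_add_le (θ := 1 / 5) (by norm_num) (B1 j k) (b1 j k - B1 j k)
      rw [add_sub_cancel] at this
      rw [Matrix.sub_apply]
      norm_num at this
      linarith [show (b1 j k - B1 j k) ^ 2 = (B1 j k - b1 j k) ^ 2 by ring]
    linarith
  calc _ ≤ η * (2 + 8 * lam) * (8 / 5 * S ^ 2) := by gcongr
    _ = 1 / 5 * (η * (16 * S ^ 2)) + 4 / 5 * (η * (16 * S ^ 2) * lam) := by ring
    _ ≤ 1 := by linarith

lemma exists_pos_le_of_ne_zero (b : Matrix (Fin p) (Fin K) ℝ) (hb : ∀ j k, 0 ≤ b j k) :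
    ∃ bm : ℝ, 0 < bm ∧ ∀ j k, b j k ≠ 0 → bm ≤ b j k := by
  have : ∀ q : Fin p × Fin K, ∀ᶠ x in nhdsWithin (0 : ℝ) (Set.Ioi 0),
      b q.1 q.2 ≠ 0 → x ≤ b q.1 q.2 := by
    intro q
    by_cases h : b q.1 q.2 = 0
    · simp [h]
    · have hpos : 0 < b q.1 q.2 := lt_of_le_of_ne (hb _ _) (Ne.symm h)
      filter_upwards [nhdsWithin_le_nhds (Iio_mem_nhds hpos)] with x hx _ using hx.le
  obtain ⟨x, hx, hx0⟩ := ((Filter.eventually_all.2 this).and self_mem_nhdsWithin).exists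
  exact ⟨x, hx0, fun j k => hx (j, k)⟩

lemma exists_one_le_abs_le (b : Matrix (Fin p) (Fin K) ℝ) :
    ∃ R : ℝ, 1 ≤ R ∧ ∀ j k, |b j k| ≤ R := by
  refine ⟨1 + frobSq b, by linarith [frobSq_nonneg b], fun j k => ?_⟩
  have h1 := sq_le_frobSq b j k
  have h2 : 2 * |b j k| ≤ 1 + |b j k| ^ 2 := by linarith [sq_nonneg (|b j k| - 1)]
  rw [sq_abs] at h2
  linarith [abs_nonneg (b j k), frobSq_nonneg b]

lemma eventually_small {f : ℝ → ℝ} (hf : Continuous f) (h0 : f 0 = 0) {c : ℝ} (hc : 0 < c) :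
    ∀ᶠ x in nhdsWithin (0 : ℝ) (Set.Ioi 0), f x < c :=
  nhdsWithin_le_nhds ((hf.tendsto 0).eventually (gt_mem_nhds (h0.symm ▸ hc)))

/-- A recursion that contracts only below the level `τ`, with a perturbation too small to leave it,
stays below `τ` and converges geometrically up to the perturbation. -/
lemma le_of_contraction {d : ℕ → ℝ} {β C e τ : ℝ} (hβ0 : 0 ≤ β) (hC : 0 ≤ C)
    (he : C * (1 - β) * e ≤ (1 - β) * τ) (he0 : 0 ≤ e) (h0 : d 0 ≤ τ)
    (hd : ∀ t, d t ≤ τ → d (t + 1) ≤ β * d t + C * (1 - β) * e) (T : ℕ) :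
    d T ≤ τ ∧ d T ≤ β ^ T * d 0 + C * e := by
  induction T with
  | zero => exact ⟨h0, by simpa using mul_nonneg hC he0⟩
  | succ t ih =>
    have h1 := hd t ih.1
    have h2 := mul_le_mul_of_nonneg_left ih.1 hβ0
    have h3 := mul_le_mul_of_nonneg_left ih.2 hβ0
    refine ⟨by linarith, ?_⟩
    rw [pow_succ]
    linarith

/-- The contraction bound holds on the event that the averaged noise is small, where the
threshold `ε` may depend on the truth and on the dimensions. -/
lemma exists_noise_threshold {μ lam η σ q : ℝ} {s : ℕ} (hμ : 0 < μ) (hlam : 0 < lam) (hη : 0 < η)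
    (hσ0 : 0 < σ) (hs : 1 ≤ s) (hq0 : 0 < q) (hq1 : q ≤ 1)
    (hq : q ≤ η * (min μ (4 * lam) * σ)) {b1 b2 : Matrix (Fin p) (Fin K) ℝ}
    (hb1 : ∀ j k, 0 ≤ b1 j k) (hb2 : ∀ j k, 0 ≤ b2 j k)
    (hbal : ∀ k, ∑ j, b1 j k ^ 2 = ∑ j, b2 j k ^ 2) (hn1 : nnz b1 ≤ s) (hn2 : nnz b2 ≤ s)
    (hσ : ∀ k, σ ≤ ∑ j, b1 j k ^ 2) {m : ℕ → Fin K → ℝ} (hm0 : ∀ i k, 0 ≤ m i k)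
    (hm1 : ∀ i, ∑ k, m i k = 1) :
    ∃ ε : ℝ, 0 < ε ∧ ∀ (n : ℕ) (E : ℕ → Matrix (Fin p) (Fin p) ℝ), TopicCondition μ n m →
      ∑ k, frobSq (noiseAvg n m E k) ≤ ε ^ 2 → ∀ B1 B2 : ℕ → Matrix (Fin p) (Fin K) ℝ,
      IsRun n m (observe b1 b2 m E) lam η s B1 B2 →
      η ≤ 1 / (16 * specNorm (Matrix.fromCols (B1 0) (B2 0)) ^ 2) *
        min (1 / (2 * (μ + 1))) (min 1 (1 / lam)) →
      ∀ T, dSq (B1 T) (B2 T) b1 b2 ≤ (1 - q / 4) ^ T * dSq (B1 0) (B2 0) b1 b2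
        + (1 + (q / 2)⁻¹) * (4 * (s ^ 2 * η)) * (4 / q) * statError s n m E ^ 2 := by
  obtain ⟨bm1, hbm1p, hbm1⟩ := exists_pos_le_of_ne_zero b1 hb1
  obtain ⟨bm2, hbm2p, hbm2⟩ := exists_pos_le_of_ne_zero b2 hb2
  obtain ⟨R1, hR1p, hR1⟩ := exists_one_le_abs_le b1
  obtain ⟨R2, hR2p, hR2⟩ := exists_one_le_abs_le b2
  set bm := min bm1 bm2 with hbm
  have hbmp : 0 < bm := lt_min hbm1p hbm2p
  set R := max R1 R2 with hR
  set a := η * p * R * (4 + 12 * lam) with ha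
  set C' := (1 + (q / 2)⁻¹) * (4 * (s ^ 2 * η)) with hC'
  have hR0 : 1 ≤ R := hR1p.trans (le_max_left _ _)
  have ha0 : 0 ≤ a := by positivity
  have hC'0 : 0 ≤ C' := by positivity
  -- the radius `τ` of the neighbourhood in which one iteration contracts
  obtain ⟨τ, ⟨⟨⟨hτ1, hτσ⟩, hτγ⟩, hτbm⟩, hτ0⟩ :=
    (((((eventually_small (f := fun x => x) (by fun_prop) rfl one_pos).and
      (eventually_small (f := fun x => 24 * x ^ 2) (by fun_prop) (by simp) hσ0)).and
      (eventually_small (f := fun x => (1 + (q / 2)⁻¹) * (4 * (p * K * ((a + 1) * x) ^ 2)))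
        (by fun_prop) (by simp) (by positivity : 0 < q / 4))).and
      (eventually_small (f := fun x => 2 * (x + x + (a + 1) * x * x)) (by fun_prop) (by simp)
        hbmp)).and self_mem_nhdsWithin).exists
  have hτ0 : 0 < τ := hτ0
  -- the noise level that keeps the run in this neighbourhood
  obtain ⟨ε, ⟨⟨⟨⟨⟨⟨h1, h2⟩, h3⟩, h4⟩, h5⟩, h6⟩, hε0⟩⟩ :=
    (((((((eventually_small (f := fun x => η * p * x) (by fun_prop) (by simp) hτ0).and
      (eventually_small (f := fun x => p * (η * (x * R))) (by fun_prop) (by simp) hτ0)).and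
      (eventually_small (f := fun x => 4 * (2 * x / μ)) (by fun_prop) (by simp) hσ0)).and
      (eventually_small (f := fun x => 4 * (p * (2 * x / μ))) (by fun_prop) (by simp) hσ0)).and
      (eventually_small (f := fun x => K * (14 * (2 * x / μ))) (by fun_prop) (by simp)
        (by positivity : 0 < τ ^ 2))).and
      (eventually_small (f := fun x => C' * x ^ 2) (by fun_prop) (by simp)
        (by positivity : 0 < q / 4 * τ ^ 2))).and self_mem_nhdsWithin).exists
  have hε0 : 0 < ε := hε0
  refine ⟨ε, hε0, fun n E hT hG B1 B2 hrun hstep T => ?_⟩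
  have hinit := hrun.1.dSq_le hμ hσ0 hT hb1 hb2 hbal hσ hε0.le hG h3.le h4
  have hd0 : dSq (B1 0) (B2 0) b1 b2 ≤ τ ^ 2 := hinit.trans h5.le
  have hst : ∀ k, η * (2 + 8 * lam) * ∑ j, b1 j k ^ 2 ≤ 1 := fun k =>
    step_size_bound hlam hη hstep k (hσ k) (by
      have : frobSq (B1 0 - b1) ≤ dSq (B1 0) (B2 0) b1 b2 :=
        le_add_of_nonneg_right (frobSq_nonneg _)
      linarith)
  have hg : ∀ k j l, |noiseAvg n m E k j l| ≤ ε := fun k j l =>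
    abs_le_of_sq_le_sq ((sq_le_frobSq _ j l).trans ((Finset.single_le_sum
      (f := fun k => frobSq (noiseAvg n m E k)) (fun _ _ => frobSq_nonneg _)
      (Finset.mem_univ k)).trans hG)) hε0.le
  have he : C' * statError s n m E ^ 2 ≤ q / 4 * τ ^ 2 := by
    exact (mul_le_mul_of_nonneg_left ((sq_statError_le s).trans hG) hC'0).trans h6.le
  have key := le_of_contraction (d := fun t => dSq (B1 t) (B2 t) b1 b2) (β := 1 - q / 4)
    (C := C' * (4 / q)) (e := statError s n m E ^ 2) (τ := τ ^ 2) (by linarith) (by positivity)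
    (by
      have : C' * (4 / q) * (1 - (1 - q / 4)) = C' := by field_simp; ring
      rw [this]; linarith) (sq_nonneg _) hd0
    (fun t ht => by
      have : C' * (4 / q) * (1 - (1 - q / 4)) = C' := by field_simp; ring
      rw [this]
      exact (hrun.2 t).dSq_le (R := R) (bm := bm) (τ := τ) (c0 := τ) (γ := (a + 1) * τ) (g := ε)
        hη hμ hlam hT hm0 hm1 hb1 hb2 hbal hσ hst hs hn1 hn2 hR0
        (fun j k => (hR1 j k).trans (le_max_left _ _))
        (fun j k => (hR2 j k).trans (le_max_right _ _))
        (fun j k h => (min_le_left _ _).trans (hbm1 j k h))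
        (fun j k h => (min_le_right _ _).trans (hbm2 j k h)) hg hτ0.le hτ1.le hq0 hq h2.le
        (by positivity) (by linarith) hτbm hτγ.le ht)
    T
  exact key.2

end Deterministic

/-! ### Concentration of the averaged noise -/

section Probability

variable {p K : ℕ} {Om : Type*} [MeasurableSpace Om] {P : Measure Om} [IsProbabilityMeasure P]

/-- The weighted averages of the noise entries have variance `O(1/n)`. -/
lemma NoiseCondition.integral_sq_noiseAvg_le {E : ℕ → Om → Matrix (Fin p) (Fin p) ℝ} {V : ℝ}
    (hE : NoiseCondition P E V) {m : ℕ → Fin K → ℝ} (hm0 : ∀ i k, 0 ≤ m i k)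
    (hm1 : ∀ i, ∑ k, m i k = 1) {n : ℕ} (hn : 0 < n) (k : Fin K) (j l : Fin p) :
    MemLp (fun w => noiseAvg n m (fun i => E i w) k j l) 2 P ∧
      ∫ w, noiseAvg n m (fun i => E i w) k j l ^ 2 ∂P ≤ V / n := by
  set X : ℕ → Om → ℝ := fun i w => m i k * E i w j l with hX
  have hXL : ∀ i, MemLp (X i) 2 P := fun i => (hE.memLp i j l).const_mul _
  have hXm : ∀ i, ∫ w, X i w ∂P = 0 := fun i => by
    rw [hX]; simp only [integral_const_mul, hE.mean i j l, mul_zero]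
  have hXv : ∀ i, ∫ w, X i w ^ 2 ∂P ≤ V := fun i => by
    simp only [hX, mul_pow, integral_const_mul]
    refine le_trans ?_ (hE.second i j l)
    refine mul_le_of_le_one_left (integral_nonneg fun _ => sq_nonneg _) ?_
    exact pow_le_one₀ (hm0 i k) (weight_le_one (hm0 i) (hm1 i) k)
  have hindep : ∀ i i', i ≠ i' → IndepFun (X i) (X i') P := fun i i' hne =>
    (hE.indep.indepFun hne).comp (φ := fun x : Fin p × Fin p → ℝ => m i k * x (j, l))
      (ψ := fun x : Fin p × Fin p → ℝ => m i' k * x (j, l))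
      (by fun_prop) (by fun_prop)
  have e : (fun w => noiseAvg n m (fun i => E i w) k j l)
      = fun w => 1 / (n : ℝ) * ∑ i ∈ Finset.range n, X i w := by
    funext w
    rw [noiseAvg_apply, avg]
  have hS : MemLp (∑ i ∈ Finset.range n, X i) 2 P := memLp_finsetSum' _ fun i _ => hXL i
  have hvar : ∫ w, (∑ i ∈ Finset.range n, X i w) ^ 2 ∂P
      = ∑ i ∈ Finset.range n, ∫ w, X i w ^ 2 ∂P := by
    have hv := IndepFun.variance_sum (s := Finset.range n) (fun i _ => hXL i)
      (fun i _ i' _ hne => hindep i i' hne)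
    rw [variance_of_integral_eq_zero hS.aemeasurable] at hv
    · simp only [Finset.sum_apply] at hv
      rw [hv]
      exact Finset.sum_congr rfl fun i _ =>
        variance_of_integral_eq_zero (hXL i).aemeasurable (hXm i)
    · simp only [Finset.sum_apply]
      rw [integral_finsetSum _ fun i _ => (hXL i).integrable one_le_two]
      exact Finset.sum_eq_zero fun i _ => hXm i
  constructor
  · rw [e]
    have := hS.const_mul (1 / (n : ℝ))
    simpa only [Finset.sum_apply] using this
  · have e2 : (fun w => noiseAvg n m (fun i => E i w) k j l ^ 2)
        = fun w => (1 / (n : ℝ)) ^ 2 * (∑ i ∈ Finset.range n, X i w) ^ 2 := by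
      funext w
      rw [congrFun e w, mul_pow]
    rw [e2, integral_const_mul, hvar]
    have hsum : ∑ i ∈ Finset.range n, ∫ w, X i w ^ 2 ∂P ≤ n * V := by
      refine (Finset.sum_le_sum fun i _ => hXv i).trans ?_
      simp
    have hn' : (0 : ℝ) < n := by exact_mod_cast hn
    calc _ ≤ (1 / (n : ℝ)) ^ 2 * (n * V) := by gcongr
      _ = V / n := by field_simp

/-- The averaged noise is eventually small with high probability. -/
lemma NoiseCondition.exists_event {E : ℕ → Om → Matrix (Fin p) (Fin p) ℝ} {V : ℝ}
    (hE : NoiseCondition P E V) {m : ℕ → Fin K → ℝ} (hm0 : ∀ i k, 0 ≤ m i k)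
    (hm1 : ∀ i, ∑ k, m i k = 1) {ε δ : ℝ} (hε : 0 < ε) (hδ : 0 < δ) :
    ∃ N : ℕ, ∀ n, N ≤ n → ∃ A : Set Om, MeasurableSet A ∧ 1 - δ ≤ P.real A ∧
      ∀ w ∈ A, ∑ k, frobSq (noiseAvg n m (fun i => E i w) k) ≤ ε ^ 2 := by
  obtain ⟨N, hN⟩ := exists_nat_gt (K * (p * (p * V)) / (ε ^ 2 * δ))
  refine ⟨N + 1, fun n hn => ?_⟩
  have hn0 : 0 < n := by omega
  have hn' : (0 : ℝ) < n := by exact_mod_cast hn0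
  set Z : Om → ℝ := fun w => ∑ k, frobSq (noiseAvg n m (fun i => E i w) k) with hZ
  have hI : ∀ k j l, Integrable (fun w => noiseAvg n m (fun i => E i w) k j l ^ 2) P :=
    fun k j l => (hE.integral_sq_noiseAvg_le hm0 hm1 hn0 k j l).1.integrable_sq
  have hZI : Integrable Z P := integrable_finsetSum _ fun k _ => integrable_finsetSum _ fun j _ =>
    integrable_finsetSum _ fun l _ => hI k j l
  have hZ0 : ∀ w, 0 ≤ Z w := fun w => Finset.sum_nonneg fun k _ => frobSq_nonneg _
  have hZb : ∫ w, Z w ∂P ≤ K * (p * (p * (V / n))) := by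
    simp only [hZ, frobSq]
    rw [integral_finsetSum _ fun k _ => integrable_finsetSum _ fun j _ =>
      integrable_finsetSum _ fun l _ => hI k j l]
    have h1 : ∀ k : Fin K, ∫ w, ∑ j, ∑ l, noiseAvg n m (fun i => E i w) k j l ^ 2 ∂P
        ≤ p * (p * (V / n)) := by
      intro k
      rw [integral_finsetSum _ fun j _ => integrable_finsetSum _ fun l _ => hI k j l]
      have h2 : ∀ j : Fin p, ∫ w, ∑ l, noiseAvg n m (fun i => E i w) k j l ^ 2 ∂P
          ≤ p * (V / n) := by
        intro j
        rw [integral_finsetSum _ fun l _ => hI k j l]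
        refine (Finset.sum_le_sum fun l _ =>
          (hE.integral_sq_noiseAvg_le hm0 hm1 hn0 k j l).2).trans ?_
        simp
      refine (Finset.sum_le_sum fun j _ => h2 j).trans ?_
      simp
    refine (Finset.sum_le_sum fun k _ => h1 k).trans ?_
    simp
  have hmarkov := mul_meas_ge_le_integral_of_nonneg (Filter.Eventually.of_forall hZ0) hZI (ε ^ 2)
  set bad : Set Om := {w | ε ^ 2 ≤ Z w} with hbad
  have hP : P.real (toMeasurable P bad) ≤ δ := by
    have h1 : P.real (toMeasurable P bad) = P.real bad := by
      simp [Measure.real, measure_toMeasurable]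
    rw [h1]
    have h2 : ε ^ 2 * P.real bad ≤ K * (p * (p * (V / n))) := hmarkov.trans hZb
    have h3 : K * (p * (p * V)) ≤ ε ^ 2 * δ * n := by
      rw [div_lt_iff₀ (by positivity)] at hN
      have : (N : ℝ) ≤ n := by exact_mod_cast (Nat.le_succ N).trans hn
      have := mul_le_mul_of_nonneg_right this (by positivity : 0 ≤ ε ^ 2 * δ)
      linarith
    have h4 : K * (p * (p * (V / n))) ≤ ε ^ 2 * δ := by
      rw [show (K : ℝ) * (p * (p * (V / n))) = K * (p * (p * V)) / n by ring,
        div_le_iff₀ hn']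
      exact h3
    exact le_of_mul_le_mul_left (h2.trans h4) (by positivity)
  refine ⟨(toMeasurable P bad)ᶜ, (measurableSet_toMeasurable P bad).compl, ?_, fun w hw => ?_⟩
  · rw [probReal_compl_eq_one_sub (measurableSet_toMeasurable P bad)]
    linarith
  · by_contra hcon
    exact hw (subset_toMeasurable P bad (le_of_not_ge hcon))

end Probability

end InflRec

open InflRec in
theorem theorem1
    (μ lam η σ c : ℝ) (hμ : 0 < μ) (hlam : 0 < lam) (hη : 0 < η) (hσ : 0 < σ) (hc : 1 ≤ c)
    (sstar s : ℕ) (hs : (s : ℝ) = c * (sstar : ℝ)) :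
    ∃ β C : ℝ, 0 ≤ β ∧ β < 1 ∧ 0 ≤ C ∧
      ∀ (p K : ℕ) (B1s B2s : Matrix (Fin p) (Fin K) ℝ),
        -- the true pair is nonnegative, balanced and sparse, and each `Θ_k*` has norm at least `σ`
        (∀ j k, 0 ≤ B1s j k) → (∀ j k, 0 ≤ B2s j k) →
        (∀ k, ∑ j, B1s j k ^ 2 = ∑ j, B2s j k ^ 2) →
        nnz B1s = sstar → nnz B2s = sstar →
        (∀ k, σ ≤ specNorm (theta B1s B2s k)) →
        -- the known topic distributions
        ∀ m : ℕ → Fin K → ℝ, (∀ i k, 0 ≤ m i k) → (∀ i, ∑ k, m i k = 1) →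
        -- the noise
        ∀ (Om : Type*) [MeasurableSpace Om] (P : Measure Om) [IsProbabilityMeasure P]
          (E : ℕ → Om → Matrix (Fin p) (Fin p) ℝ) (V : ℝ), NoiseCondition P E V →
        -- `n` large enough, with probability at least `1 - δ`
        ∀ δ : ℝ, 0 < δ → ∃ N : ℕ, ∀ n : ℕ, N ≤ n → TopicCondition μ n m →
          ∃ A : Set Om, MeasurableSet A ∧ 1 - δ ≤ P.real A ∧ ∀ w ∈ A,
            ∀ B1 B2 : ℕ → Matrix (Fin p) (Fin K) ℝ,
              IsRun n m (observe B1s B2s m (fun i => E i w)) lam η s B1 B2 →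
              η ≤ 1 / (16 * specNorm (Matrix.fromCols (B1 0) (B2 0)) ^ 2) *
                min (1 / (2 * (μ + 1))) (min 1 (1 / lam)) →
              ∀ T : ℕ, dSq (B1 T) (B2 T) B1s B2s ≤
                β ^ T * dSq (B1 0) (B2 0) B1s B2s +
                  C * statError s n m (fun i => E i w) ^ 2 := by
  have hν : 0 < min μ (4 * lam) := lt_min hμ (by positivity)
  set q : ℝ := min (η * (min μ (4 * lam) * σ)) 1 with hq
  have hq0 : 0 < q := lt_min (by positivity) one_pos
  have hq1 : q ≤ 1 := min_le_right _ _
  refine ⟨1 - q / 4, (1 + (q / 2)⁻¹) * (4 * (s ^ 2 * η)) * (4 / q), by linarith, by linarith,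
    by positivity, ?_⟩
  intro p K b1 b2 hb1 hb2 hbal hn1 hn2 hσ' m hm0 hm1 Om _ P _ E V hE δ hδ
  have hcol : ∀ k, σ ≤ ∑ j, b1 j k ^ 2 := fun k => by
    have h0 : 0 ≤ ∑ j, b1 j k ^ 2 := Finset.sum_nonneg fun _ _ => sq_nonneg _
    have h := (hσ' k).trans (specNorm_vecMulVec_le (b1.col k) (b2.col k)
      (r := √(∑ j, b1 j k ^ 2)) (Real.sq_sqrt h0).symm
      (by rw [Real.sq_sqrt h0, hbal]; rfl))
    rwa [Real.sq_sqrt h0] at h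
  have hle : sstar ≤ s := by
    have : (sstar : ℝ) ≤ s := by
      rw [hs]; exact le_mul_of_one_le_left (Nat.cast_nonneg _) hc
    exact_mod_cast this
  rcases Nat.eq_zero_or_pos s with h0 | hs1
  · -- without nonzero entries there are no topics, and all distances vanish
    have hK : K = 0 := by
      by_contra hK
      have hb : ∀ j k, b1 j k = 0 := by
        have h1 : nnz b1 = 0 := by omega
        rw [nnz, Set.ncard_eq_zero (Set.toFinite _)] at h1
        intro j k
        by_contra hne
        exact (Set.eq_empty_iff_forall_notMem.1 h1 (j, k)) hne
      have h2 := hcol ⟨0, Nat.pos_of_ne_zero hK⟩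
      simp [hb] at h2
      linarith
    subst hK
    refine ⟨0, fun n _ _ => ⟨Set.univ, MeasurableSet.univ, by simp [hδ.le], ?_⟩⟩
    intro w _ B1 B2 _ _ T
    have hz : ∀ T, dSq (B1 T) (B2 T) b1 b2 = 0 := fun T => by simp [dSq, frobSq]
    rw [hz, hz, mul_zero, zero_add]
    positivity
  · obtain ⟨ε, hε, hdet⟩ := exists_noise_threshold hμ hlam hη hσ hs1 hq0 hq1 (min_le_left _ _)
      hb1 hb2 hbal (hn1.trans_le hle) (hn2.trans_le hle) hcol hm0 hm1
    obtain ⟨N, hN⟩ := hE.exists_event hm0 hm1 hε hδ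
    refine ⟨N, fun n hn hT => ?_⟩
    obtain ⟨A, hA, hPA, hw⟩ := hN n hn
    exact ⟨A, hA, hPA, fun w hwA B1 B2 hrun hstep T =>
      hdet n (fun i => E i w) hT (hw w hwA) B1 B2 hrun hstep T⟩
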